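/- Let $m\ge 2$ and let $C_1,\dots,C_m\in\mathbb C^{3\times 4}$ be matrices of rank $3$ (pinhole cameras) whose centers $c_i=\ker C_i\in\mathbb P^3$ are pairwise distinct. Here $\mathbb P^n$ denotes complex projective space, and a line in $\mathbb P^2$ is identified with its linear equation $\ell\in\mathbb P^2$, so that $x$ lies on the line if and only if $x^T\ell=0$. Let $\mathbb G$ be the Grassmannian of lines in $\mathbb P^3$, and let $$\Upsilon:\mathbb G\dashrightarrow(\mathbb P^2)^m,\qquad L\mapsto (C_1\cdot L,\dots,C_m\cdot L),$$ be the map that sends a line $L$ passing through none of the $c_i$ to the tuple of (equations of) its images under the cameras. The line multiview variety $\mathcal L$ is the Zariski closure in $(\mathbb P^2)^m$ of the image of $\Upsilon$. For $\ell=(\ell_1,\dots,\ell_m)\in(\mathbb P^2)^m$ let $M(\ell)=\begin{bmatrix}C_1^T\ell_1&\cdots&C_m^T\ell_m\end{bmatrix}$, a $4\times m$ matrix whose rank does not depend on the chosen representatives of the $\ell_i$, and put $$\mathcal V=\{\ell\in(\mathbb P^2)^m \mid \operatorname{rank} M(\ell)\le 2\}.$$ Then $\mathcal L=\mathcal V$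 if and only if no four of the centers $c_1,\dots,c_m$ lie on a common line in $\mathbb P^3$. Moreover, no four of the centers lie on a common line if and only if $\mathcal V$ is irreducible (in the Zariski topology) and of dimension $4$. -/

import Mathlib

open scoped LinearAlgebra.Projectivization

noncomputable section

namespace LineMultiview

/-! ### The Zariski topology on `(ℙ²)^m` -/

/-- The product `(ℙ²)^m` of complex projective planes. -/
def P2Pow (m : ℕ) : Type := Fin m → ℙ ℂ (Fin 3 → ℂ)

/-- The coordinate ring `ℂ[x_{i,j} : i < m, j < 3]`. -/
abbrev CoordRing (m : ℕ) : Type := MvPolynomial (Fin m × Fin 3) ℂ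

/-- `f` is multihomogeneous: homogeneous of some degree `d i` in each group of three variables
`x_{i,0}, x_{i,1}, x_{i,2}`. -/
def IsMultihomogeneous {m : ℕ} (f : CoordRing m) : Prop :=
  ∃ d : Fin m → ℕ,
    MvPolynomial.IsWeightedHomogeneous (fun p : Fin m × Fin 3 => (Pi.single p.1 1 : Fin m → ℕ)) f d

/-- Homogeneous coordinates of a point of `(ℙ²)^m`. For a multihomogeneous polynomial, vanishing at
these coordinates does not depend on the chosen representatives. -/
def coords {m : ℕ} (x : P2Pow m) : Fin m × Fin 3 → ℂ := fun p => (x p.1).rep p.2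

/-- The common zero set in `(ℙ²)^m` of a set of polynomials. -/
def zeroSet {m : ℕ} (S : Set (CoordRing m)) : Set (P2Pow m) :=
  {x | ∀ f ∈ S, MvPolynomial.eval (coords x) f = 0}

/-- A (multiprojective) algebraic variety: the zero set of multihomogeneous polynomials. -/
def IsAlgebraic {m : ℕ} (X : Set (P2Pow m)) : Prop :=
  ∃ S : Set (CoordRing m), (∀ f ∈ S, IsMultihomogeneous f) ∧ X = zeroSet S

theorem isAlgebraic_empty {m : ℕ} : IsAlgebraic (∅ : Set (P2Pow m)) := by
  refine ⟨{1}, ?_, ?_⟩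
  · rintro f rfl
    exact ⟨0, MvPolynomial.isWeightedHomogeneous_one ℂ _⟩
  · ext x
    simp [zeroSet]

theorem isAlgebraic_sInter {m : ℕ} {A : Set (Set (P2Pow m))} (hA : ∀ X ∈ A, IsAlgebraic X) :
    IsAlgebraic (⋂₀ A) := by
  choose! S hS using hA
  refine ⟨⋃ X ∈ A, S X, ?_, ?_⟩
  · intro f hf
    simp only [Set.mem_iUnion] at hf
    obtain ⟨X, hX, hf⟩ := hf
    exact (hS X hX).1 f hf
  · ext x
    simp only [Set.mem_sInter, zeroSet, Set.mem_iUnion, Set.mem_ofPred_eq]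
    constructor
    · rintro h f ⟨X, hX, hf⟩
      have hx := h X hX
      rw [(hS X hX).2] at hx
      exact hx f hf
    · intro h X hX
      rw [(hS X hX).2]
      exact fun f hf => h f ⟨X, hX, hf⟩

theorem isAlgebraic_union {m : ℕ} {X Y : Set (P2Pow m)} (hX : IsAlgebraic X)
    (hY : IsAlgebraic Y) : IsAlgebraic (X ∪ Y) := by
  obtain ⟨S, hS, rfl⟩ := hX
  obtain ⟨T, hT, rfl⟩ := hY
  refine ⟨{h | ∃ f ∈ S, ∃ g ∈ T, h = f * g}, ?_, ?_⟩
  · rintro h ⟨f, hf, g, hg, rfl⟩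
    obtain ⟨d, hd⟩ := hS f hf
    obtain ⟨e, he⟩ := hT g hg
    exact ⟨d + e, hd.mul he⟩
  · ext x
    constructor
    · rintro (h | h) _ ⟨f, hf, g, hg, rfl⟩
      · rw [map_mul, h f hf, zero_mul]
      · rw [map_mul, h g hg, mul_zero]
    · intro h
      by_contra hc
      simp only [Set.mem_union, zeroSet, Set.mem_ofPred_eq, not_or, not_forall] at hc
      obtain ⟨⟨f, hf, hfx⟩, ⟨g, hg, hgx⟩⟩ := hc
      have := h (f * g) ⟨f, hf, g, hg, rfl⟩
      rw [map_mul] at this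
      exact (mul_ne_zero hfx hgx) this

/-- The Zariski topology on `(ℙ²)^m`: the closed sets are the algebraic varieties. Closures,
irreducibility and (Krull) dimension of subsets of `(ℙ²)^m` refer to this topology. -/
instance zariskiTopology (m : ℕ) : TopologicalSpace (P2Pow m) :=
  TopologicalSpace.ofClosed {X | IsAlgebraic X} isAlgebraic_empty
    (fun _ hA => isAlgebraic_sInter fun _ hX => hA hX)
    (fun _ hX _ hY => isAlgebraic_union hX hY)

/-! ### Pinhole cameras -/

/-- A pinhole camera: a complex `3 × 4` matrix of full rank. -/
structure Camera where
  /-- the camera matrix -/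
  mat : Matrix (Fin 3) (Fin 4) ℂ
  full_rank : mat.rank = 3

/-- The linear map `ℂ⁴ → ℂ³` of a camera. -/
def Camera.lin (C : Camera) : (Fin 4 → ℂ) →ₗ[ℂ] (Fin 3 → ℂ) := C.mat.mulVecLin

theorem Camera.finrank_ker (C : Camera) : Module.finrank ℂ (LinearMap.ker C.lin) = 1 := by
  have h := LinearMap.finrank_range_add_finrank_ker C.lin
  have hr : Module.finrank ℂ (LinearMap.range C.lin) = 3 := C.full_rank
  rw [hr, Module.finrank_fin_fun] at h
  omega

/-- The camera center: the kernel of the camera matrix, as a point of `ℙ³`. -/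
def Camera.center (C : Camera) : ℙ ℂ (Fin 4 → ℂ) :=
  Projectivization.mk'' (LinearMap.ker C.lin) C.finrank_ker

/-- The Grassmannian `𝔾` of lines in `ℙ³`: a line is a two-dimensional linear subspace of `ℂ⁴`. -/
abbrev LineP3 : Type := {L : Submodule ℂ (Fin 4 → ℂ) // Module.finrank ℂ L = 2}

/-- The point `p ∈ ℙ³` lies on the line `L`. -/
def LineP3.Contains (L : LineP3) (p : ℙ ℂ (Fin 4 → ℂ)) : Prop := p.submodule ≤ L.1

/-- `ℓ ∈ ℙ²` is the linear equation of the image line `C · L`: a point `x` satisfies `xᵀ ℓ = 0`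
if and only if it lies in the image of `L` under the camera. For lines `L` not through the camera
center, this determines `ℓ` uniquely. -/
def Camera.IsImage (C : Camera) (L : LineP3) (l : ℙ ℂ (Fin 3 → ℂ)) : Prop :=
  ∀ x : Fin 3 → ℂ, x ⬝ᵥ l.rep = 0 ↔ x ∈ L.1.map C.lin

/-- The image of the joint camera map `L ↦ (C₁ · L, …, C_m · L)`, which is defined at the lines that
pass through no camera center. -/
def jointImage {m : ℕ} (C : Fin m → Camera) : Set (P2Pow m) :=
  {l | ∃ L : LineP3, (∀ i, ¬ L.Contains (C i).center) ∧ ∀ i, (C i).IsImage L (l i)}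

/-- The line multiview variety: the Zariski closure of the image of the joint camera map. -/
def lineMultiviewVariety {m : ℕ} (C : Fin m → Camera) : Set (P2Pow m) :=
  closure (jointImage C)

/-- The `4 × m` matrix `M(ℓ)` whose `i`-th column is `C_iᵀ ℓ_i`. Its rank does not depend on the
chosen representatives of the `ℓ_i`. -/
def backProjectionMatrix {m : ℕ} (C : Fin m → Camera) (l : P2Pow m) :
    Matrix (Fin 4) (Fin m) ℂ :=
  Matrix.of fun k i => ((C i).mat.transpose.mulVec (l i).rep) k

/-- The determinantal variety `{ℓ ∈ (ℙ²)^m | rank M(ℓ) ≤ 2}`. -/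
def determinantalVariety {m : ℕ} (C : Fin m → Camera) : Set (P2Pow m) :=
  {l | (backProjectionMatrix C l).rank ≤ 2}

/-- The cameras indexed by `I` are collinear: the span of their centers is a line in `ℙ³`. -/
def AreCollinear {m : ℕ} (C : Fin m → Camera) (I : Finset (Fin m)) : Prop :=
  Module.finrank ℂ (⨆ i ∈ I, (C i).center.submodule : Submodule ℂ (Fin 4 → ℂ)) = 2

end LineMultiview

end

noncomputable section

namespace LineMultiview

open MvPolynomial

variable {m : ℕ} {σ : Type*}

/-! ### Multihomogeneous polynomials and closed sets -/

/-! Each image line `ℓᵢ` is replaced by its back-projected plane `Hᵢ = Cᵢᵀ ℓᵢ`, an arbitrary plane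
through the center `cᵢ`. The rank condition says that all `Hᵢ` lie in one pencil `span {w₁, w₂}`
with base line `L`. If `cᵢ` is not on `L`, then `Hᵢ` is forced to be the plane `join w₁ w₂ cᵢ`
spanned by `L` and `cᵢ`; if `cᵢ` is on `L`, then `Hᵢ` may be any member of the pencil. So the joint
image consists of the points of 𝒱 that have a base line avoiding all centers, and since 𝒱 is closed,
ℒ ⊆ 𝒱. The question is which of the remaining points are limits.

If four centers lie on a line, then for a line through no center the cross-ratio of its planes
through these four equals the cross-ratio of the centers. This is a closed condition
(`crossRatioForm`), hence valid on ℒ; but with the common line as base, the four planes can be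
chosen as `a, a, b, b`, which violates it (`not_subset_of_areCollinear`).

If no four are collinear, `L` contains at most three centers. The planes there can first be made
pairwise distinct inside the pencil. Then `L` is moved to first order in a direction that produces
exactly these planes in the limit; such a direction exists because three distinct points of a line
can be sent to any three distinct points of ℙ¹ (`exists_interpolation`,
`mem_closure_jointImage_of_generic`).

For the second equivalence, the joint image contains a nonempty open subset of 𝒱, which is dense if
𝒱 is irreducible; hence 𝒱 = ℒ. Conversely ℒ is irreducible, being the closure of a polynomially
parametrised set, and has dimension 4: two image lines with four affine parameters determine a
generic line. The upper bound compares a chain of primes with a transcendence degree, and the lower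
bound freezes the parameters one at a time. -/

theorem IsMultihomogeneous.exists_eval_mul {f : CoordRing m} (hf : IsMultihomogeneous f) :
    ∃ d : Fin m → ℕ, ∀ (c : Fin m → ℂ) (x : Fin m × Fin 3 → ℂ),
      eval (fun p => c p.1 * x p) f = (∏ i, c i ^ d i) * eval x f := by
  obtain ⟨d, hd⟩ := hf
  refine ⟨d, fun c x => ?_⟩
  rw [eval_eq', eval_eq', Finset.mul_sum]
  refine Finset.sum_congr rfl fun s hs => ?_
  have hw := hd (mem_support_iff.mp hs)
  have hdi : ∀ i, d i = ∑ j, s (i, j) := by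
    intro i
    rw [← hw, Finsupp.weight_apply, Finsupp.sum_fintype _ _ (by simp), Finset.sum_apply,
      Fintype.sum_prod_type]
    rw [Finset.sum_eq_single i]
    · simp
    · intro b _ hb
      simp [Ne.symm hb]
    · simp
  have : ∏ p : Fin m × Fin 3, c p.1 ^ s p = ∏ i, c i ^ d i := by
    rw [Fintype.prod_prod_type]
    refine Finset.prod_congr rfl fun i _ => ?_
    rw [hdi]
    exact Finset.prod_pow_eq_pow_sum Finset.univ (fun j => s (i, j)) (c i)
  rw [← this]
  simp only [mul_pow, Finset.prod_mul_distrib]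
  ring

theorem IsMultihomogeneous.eval_mul_eq_zero_iff {f : CoordRing m} (hf : IsMultihomogeneous f)
    {c : Fin m → ℂ} (hc : ∀ i, c i ≠ 0) (x : Fin m × Fin 3 → ℂ) :
    eval (fun p => c p.1 * x p) f = 0 ↔ eval x f = 0 := by
  obtain ⟨d, hd⟩ := hf.exists_eval_mul
  rw [hd, mul_eq_zero, or_iff_right]
  exact Finset.prod_ne_zero_iff.mpr fun i _ => pow_ne_zero _ (hc i)

/-- The point of `(ℙ²)^m` with given homogeneous coordinates. -/
def pt (x : Fin m → Fin 3 → ℂ) (hx : ∀ i, x i ≠ 0) : P2Pow m :=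
  fun i => Projectivization.mk ℂ (x i) (hx i)

theorem exists_rep_pt (x : Fin m → Fin 3 → ℂ) (hx : ∀ i, x i ≠ 0) :
    ∃ c : Fin m → ℂ, (∀ i, c i ≠ 0) ∧ ∀ i, (pt x hx i).rep = c i • x i := by
  have : ∀ i, ∃ a : ℂˣ, a • x i = (pt x hx i).rep :=
    fun i => Projectivization.exists_smul_eq_mk_rep ℂ (x i) (hx i)
  choose a ha using this
  exact ⟨fun i => a i, fun i => (a i).ne_zero, fun i => (ha i).symm⟩

/-- `coords` depends on the representatives chosen by `Projectivization.rep`; this allows vanishing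
to be tested on any homogeneous coordinates. -/
theorem eval_coords_pt {f : CoordRing m} (hf : IsMultihomogeneous f) (x : Fin m → Fin 3 → ℂ)
    (hx : ∀ i, x i ≠ 0) :
    eval (coords (pt x hx)) f = 0 ↔ eval (fun p => x p.1 p.2) f = 0 := by
  obtain ⟨c, hc, h⟩ := exists_rep_pt x hx
  rw [← hf.eval_mul_eq_zero_iff hc (fun p => x p.1 p.2)]
  have : coords (pt x hx) = fun p => c p.1 * x p.1 p.2 := by
    funext p
    simp [coords, h]
  rw [this]

theorem pt_rep (l : P2Pow m) : pt (fun i => (l i).rep) (fun i => (l i).rep_nonzero) = l :=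
  funext fun i => (l i).mk_rep

theorem pt_eq_of_smul {x y : Fin m → Fin 3 → ℂ} (hx : ∀ i, x i ≠ 0) (hy : ∀ i, y i ≠ 0)
    (h : ∀ i, ∃ c : ℂ, c • y i = x i) : pt x hx = pt y hy :=
  funext fun i => (Projectivization.mk_eq_mk_iff' ℂ _ _ _ _).mpr (h i)

theorem isClosed_iff_isAlgebraic {X : Set (P2Pow m)} : IsClosed X ↔ IsAlgebraic X := by
  rw [← isOpen_compl_iff]
  show IsAlgebraic Xᶜᶜ ↔ IsAlgebraic X
  rw [compl_compl]

theorem isClosed_zeroLocus {f : CoordRing m} (hf : IsMultihomogeneous f) :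
    IsClosed {l : P2Pow m | eval (coords l) f = 0} :=
  isClosed_iff_isAlgebraic.mpr ⟨{f}, by simpa using hf, by ext; simp [zeroSet]⟩

theorem mem_closure_iff_eval {S : Set (P2Pow m)} {l : P2Pow m} :
    l ∈ closure S ↔ ∀ f : CoordRing m, IsMultihomogeneous f →
      (∀ s ∈ S, eval (coords s) f = 0) → eval (coords l) f = 0 := by
  constructor
  · intro h f hf hS
    exact (isClosed_zeroLocus hf).closure_subset_iff.mpr hS h
  · intro h
    obtain ⟨T, hT, hTS⟩ := isClosed_iff_isAlgebraic.mp (isClosed_closure (s := S))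
    rw [hTS]
    intro f hf
    refine h f (hT f hf) fun s hs => ?_
    have := subset_closure hs
    rw [hTS] at this
    exact this f hf

theorem exists_eval_ne_zero_of_isOpen {U : Set (P2Pow m)} (hU : IsOpen U) {l : P2Pow m}
    (hl : l ∈ U) : ∃ f : CoordRing m, IsMultihomogeneous f ∧ eval (coords l) f ≠ 0 ∧
      ∀ s, eval (coords s) f ≠ 0 → s ∈ U := by
  have : l ∉ closure Uᶜ := by rw [hU.isClosed_compl.closure_eq]; simpa using hl
  rw [mem_closure_iff_eval] at this
  push Not at this
  obtain ⟨f, hf, hS, hne⟩ := this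
  exact ⟨f, hf, hne, fun s hs => by_contra fun hsU => hs (hS s hsU)⟩

/-! ### Polynomial functions and polynomially parametrised sets -/

/-- The algebra of polynomial functions in the variables `σ`. -/
def polyFun (σ : Type*) : Subalgebra ℂ ((σ → ℂ) → ℂ) :=
  (aeval (R := ℂ) fun (s : σ) (a : σ → ℂ) => a s).range

theorem aeval_coord_apply (P : MvPolynomial σ ℂ) (a : σ → ℂ) :
    aeval (R := ℂ) (fun (s : σ) (a : σ → ℂ) => a s) P a = eval a P := by
  induction P using MvPolynomial.induction_on with
  | C c => simp
  | add p q hp hq => simp [hp, hq]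
  | mul_X p i hp => simp [hp]

theorem mem_polyFun {f : (σ → ℂ) → ℂ} :
    f ∈ polyFun σ ↔ ∃ P : MvPolynomial σ ℂ, ∀ a, f a = eval a P := by
  constructor
  · rintro ⟨P, rfl⟩
    exact ⟨P, fun a => aeval_coord_apply P a⟩
  · rintro ⟨P, hP⟩
    exact ⟨P, funext fun a => (aeval_coord_apply P a).trans (hP a).symm⟩

theorem coord_mem_polyFun (s : σ) : (fun a : σ → ℂ => a s) ∈ polyFun σ :=
  mem_polyFun.mpr ⟨X s, by simp⟩

theorem const_mem_polyFun (c : ℂ) : (fun _ : σ → ℂ => c) ∈ polyFun σ :=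
  mem_polyFun.mpr ⟨C c, by simp⟩

theorem eval_mem_polyFun {τ : Type*} {P : (σ → ℂ) → τ → ℂ}
    (hP : ∀ t, (fun a => P a t) ∈ polyFun σ) (f : MvPolynomial τ ℂ) :
    (fun a => eval (P a) f) ∈ polyFun σ := by
  induction f using MvPolynomial.induction_on with
  | C c => simpa using const_mem_polyFun c
  | add p q hp hq => simp only [map_add]; exact add_mem hp hq
  | mul_X p i hp => simp only [map_mul, eval_X]; exact mul_mem hp (hP i)

/-- Irreducibility of affine space: a product of nonzero polynomials over the infinite field ℂ is
nonzero at some point. All later genericity arguments rest on this. -/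
theorem exists_forall_ne_zero {ι : Type*} [Finite ι] {f : ι → (σ → ℂ) → ℂ}
    (hf : ∀ i, f i ∈ polyFun σ) (hne : ∀ i, ∃ a, f i a ≠ 0) : ∃ a, ∀ i, f i a ≠ 0 := by
  cases nonempty_fintype ι
  simp only [mem_polyFun] at hf
  choose P hP using hf
  have h0 : ∀ i, P i ≠ 0 := by
    intro i h
    obtain ⟨a, ha⟩ := hne i
    exact ha (by rw [hP, h, map_zero])
  have : (∏ i, P i) ≠ 0 := Finset.prod_ne_zero_iff.mpr fun i _ => h0 i
  by_contra! hc
  refine this (MvPolynomial.funext fun a => ?_)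
  obtain ⟨i, hi⟩ := hc a
  rw [map_prod, map_zero]
  exact Finset.prod_eq_zero (Finset.mem_univ i) (by rw [← hP, hi])

/-- A polynomial family of homogeneous coordinates. -/
def IsPolyFamily (P : (σ → ℂ) → Fin m → Fin 3 → ℂ) : Prop :=
  ∀ i j, (fun a => P a i j) ∈ polyFun σ

/-- The pull-back of a polynomial along a family of homogeneous coordinates. -/
def pullback (P : (σ → ℂ) → Fin m → Fin 3 → ℂ) (F : CoordRing m) (a : σ → ℂ) : ℂ :=
  eval (fun p => P a p.1 p.2) F

theorem IsPolyFamily.pullback_mem {P : (σ → ℂ) → Fin m → Fin 3 → ℂ} (hP : IsPolyFamily P)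
    (F : CoordRing m) : pullback P F ∈ polyFun σ := by
  have h : pullback P F = fun a => eval ((fun a p => P a p.1 p.2 : (σ → ℂ) → _ × _ → ℂ) a) F := rfl
  rw [h]
  apply eval_mem_polyFun
  intro p
  exact hP p.1 p.2

theorem pullback_eq_zero_iff {P : (σ → ℂ) → Fin m → Fin 3 → ℂ} {F : CoordRing m}
    (hF : IsMultihomogeneous F) {a : σ → ℂ} (ha : ∀ i, P a i ≠ 0) :
    pullback P F a = 0 ↔ eval (coords (pt (P a) ha)) F = 0 :=
  (eval_coords_pt hF _ ha).symm

/-- The set of points parametrised by a family of homogeneous coordinates. -/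
def locus (P : (σ → ℂ) → Fin m → Fin 3 → ℂ) : Set (P2Pow m) :=
  {l | ∃ a, ∃ h : ∀ i, P a i ≠ 0, pt (P a) h = l}

theorem IsPolyFamily.exists_generic {P : (σ → ℂ) → Fin m → Fin 3 → ℂ} (hP : IsPolyFamily P)
    (hP0 : ∀ i, ∃ a, P a i ≠ 0) {ι : Type*} [Finite ι] {f : ι → (σ → ℂ) → ℂ}
    (hf : ∀ i, f i ∈ polyFun σ) (hne : ∀ i, ∃ a, f i a ≠ 0) :
    ∃ a, (∀ i, P a i ≠ 0) ∧ ∀ i, f i a ≠ 0 := by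
  have : ∀ i, ∃ j a, P a i j ≠ 0 := by
    intro i
    obtain ⟨a, ha⟩ := hP0 i
    obtain ⟨j, hj⟩ := Function.ne_iff.mp ha
    exact ⟨j, a, hj⟩
  choose k hk using this
  obtain ⟨a, ha⟩ := exists_forall_ne_zero
    (f := Sum.elim (fun i a => P a i (k i)) f)
    (by rintro (i | i); exacts [hP i (k i), hf i])
    (by rintro (i | i); exacts [hk i, hne i])
  exact ⟨a, fun i h => ha (.inl i) (by simp [h]), fun i => ha (.inr i)⟩

/-- A point of a polynomial family lies in the closure of the generic points of the family. -/
theorem IsPolyFamily.mem_closure {P : (σ → ℂ) → Fin m → Fin 3 → ℂ} (hP : IsPolyFamily P)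
    {ι : Type*} [Finite ι] {f : ι → (σ → ℂ) → ℂ} (hf : ∀ i, f i ∈ polyFun σ)
    (hne : ∀ i, ∃ a, f i a ≠ 0) {S : Set (P2Pow m)}
    (hS : ∀ a, (∀ i, f i a ≠ 0) → ∀ h : ∀ i, P a i ≠ 0, pt (P a) h ∈ S)
    {a : σ → ℂ} (ha : ∀ i, P a i ≠ 0) : pt (P a) ha ∈ closure S := by
  rw [mem_closure_iff_eval]
  intro F hF hFS
  by_contra hc
  rw [← pullback_eq_zero_iff hF ha] at hc
  -- If `F` did not vanish at `a`, its nonvanishing would be one more generic condition, compatible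
  -- with those in `f`.
  obtain ⟨b, hb, hb'⟩ := hP.exists_generic (fun i => ⟨a, ha i⟩)
    (f := fun o : Option ι => o.elim (pullback P F) f)
    (Option.rec (hP.pullback_mem F) hf) (Option.rec ⟨a, hc⟩ hne)
  exact hb' none ((pullback_eq_zero_iff hF hb).mpr (hFS _ (hS b (fun i => hb' (some i)) hb)))

theorem IsPolyFamily.isPreirreducible_locus {P : (σ → ℂ) → Fin m → Fin 3 → ℂ}
    (hP : IsPolyFamily P) : IsPreirreducible (locus P) := by
  rintro U W hU hW ⟨_, ⟨a, ha, rfl⟩, haU⟩ ⟨_, ⟨b, hb, rfl⟩, hbW⟩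
  obtain ⟨F, hF, hFa, hFU⟩ := exists_eval_ne_zero_of_isOpen hU haU
  obtain ⟨G, hG, hGb, hGW⟩ := exists_eval_ne_zero_of_isOpen hW hbW
  rw [ne_eq, ← pullback_eq_zero_iff hF] at hFa
  rw [ne_eq, ← pullback_eq_zero_iff hG] at hGb
  obtain ⟨c, hc, hc'⟩ := hP.exists_generic (fun i => ⟨a, ha i⟩)
    (f := fun o : Bool => pullback P (cond o F G)) (fun o => hP.pullback_mem _)
    (Bool.rec ⟨b, hGb⟩ ⟨a, hFa⟩)
  refine ⟨_, ⟨c, hc, rfl⟩, hFU _ ?_, hGW _ ?_⟩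
  · rw [ne_eq, ← pullback_eq_zero_iff hF]; exact hc' true
  · rw [ne_eq, ← pullback_eq_zero_iff hG]; exact hc' false

/-! ### Linear forms -/

/-- The linear form `x ↦ x_i ⬝ b` in the `i`-th group of variables. -/
def linForm (i : Fin m) (b : Fin 3 → ℂ) : CoordRing m := ∑ k, C (b k) * X (i, k)

theorem linForm_isWeightedHomogeneous (i : Fin m) (b : Fin 3 → ℂ) :
    IsWeightedHomogeneous (fun p : Fin m × Fin 3 => (Pi.single p.1 1 : Fin m → ℕ))
      (linForm i b) (Pi.single i 1) := by
  refine IsWeightedHomogeneous.sum _ _ _ fun k _ => ?_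
  have := (isWeightedHomogeneous_C (fun p : Fin m × Fin 3 => (Pi.single p.1 1 : Fin m → ℕ))
    (b k)).mul (isWeightedHomogeneous_X ℂ (fun p : Fin m × Fin 3 => (Pi.single p.1 1 : Fin m → ℕ))
    (i, k))
  simpa using this

@[simp]
theorem eval_linForm (i : Fin m) (b : Fin 3 → ℂ) (x : Fin m × Fin 3 → ℂ) :
    eval x (linForm i b) = (fun k => x (i, k)) ⬝ᵥ b := by
  simp [linForm, dotProduct, mul_comm]

theorem isOpen_linForm_ne_zero (i : Fin m) (b : Fin 3 → ℂ) :
    IsOpen {l : P2Pow m | (l i).rep ⬝ᵥ b ≠ 0} := by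
  have := (isClosed_zeroLocus ⟨_, linForm_isWeightedHomogeneous i b⟩).isOpen_compl
  convert this using 1
  ext l
  simp [coords]

end LineMultiview

end

noncomputable section

namespace LineMultiview

open Module Submodule

variable {m n : ℕ}

/-! ### Orthogonal complements with respect to the dot product -/

/-- The subspace of vectors orthogonal to `W` with respect to the dot product. -/
def perp (W : Submodule ℂ (Fin n → ℂ)) : Submodule ℂ (Fin n → ℂ) :=
  LinearMap.BilinForm.orthogonal (dotProductBilin ℂ ℂ) W

theorem mem_perp {W : Submodule ℂ (Fin n → ℂ)} {h : Fin n → ℂ} :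
    h ∈ perp W ↔ ∀ v ∈ W, v ⬝ᵥ h = 0 := Iff.rfl

theorem nondegenerate_dotProductBilin :
    (dotProductBilin ℂ ℂ : LinearMap.BilinForm ℂ (Fin n → ℂ)).Nondegenerate := by
  constructor
  · intro x hx
    exact dotProduct_eq_zero x hx
  · intro x hx
    exact dotProduct_eq_zero x fun y => (dotProduct_comm _ _).trans (hx y)

theorem finrank_perp (W : Submodule ℂ (Fin n → ℂ)) : finrank ℂ (perp W) = n - finrank ℂ W := by
  rw [perp, LinearMap.BilinForm.finrank_orthogonal nondegenerate_dotProductBilin, finrank_fin_fun]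

theorem perp_perp (W : Submodule ℂ (Fin n → ℂ)) : perp (perp W) = W :=
  LinearMap.BilinForm.orthogonal_orthogonal nondegenerate_dotProductBilin
    (fun x y h => (dotProduct_comm y x).trans h) W

theorem mem_perp_span_singleton {v h : Fin n → ℂ} : h ∈ perp (ℂ ∙ v) ↔ h ⬝ᵥ v = 0 := by
  rw [mem_perp]
  constructor
  · intro H
    rw [dotProduct_comm]
    exact H v (mem_span_singleton_self v)
  · intro H w hw
    obtain ⟨c, rfl⟩ := mem_span_singleton.mp hw
    rw [smul_dotProduct, dotProduct_comm, H, smul_zero]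

theorem mem_perp_span_pair {u w v : Fin n → ℂ} :
    v ∈ perp (span ℂ {u, w}) ↔ u ⬝ᵥ v = 0 ∧ w ⬝ᵥ v = 0 := by
  rw [mem_perp]
  constructor
  · exact fun H => ⟨H u (subset_span (by simp)), H w (subset_span (by simp))⟩
  · rintro ⟨h1, h2⟩ x hx
    obtain ⟨a, b, rfl⟩ := mem_span_pair.mp hx
    simp [add_dotProduct, h1, h2]

theorem finrank_span_pair_of_linearIndependent {V : Type*} [AddCommGroup V] [Module ℂ V]
    {u w : V} (h : LinearIndependent ℂ ![u, w]) : finrank ℂ (span ℂ {u, w}) = 2 := by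
  have := finrank_span_eq_card h
  rw [Matrix.range_cons_cons_empty] at this
  simpa using this

theorem exists_linearIndependent_pair_span {V : Type*} [AddCommGroup V] [Module ℂ V]
    {W : Submodule ℂ V} (h : finrank ℂ W = 2) :
    ∃ u w : V, LinearIndependent ℂ ![u, w] ∧ W = span ℂ {u, w} := by
  have : FiniteDimensional ℂ W := .of_finrank_pos (by omega)
  let b := finBasisOfFinrankEq ℂ W h
  have hb : LinearIndependent ℂ ![(b 0 : V), (b 1 : V)] := by
    have := b.linearIndependent.map' W.subtype (ker_subtype W)
    have hb : ![(b 0 : V), (b 1 : V)] = W.subtype ∘ b := by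
      ext i
      fin_cases i <;> rfl
    rwa [hb]
  refine ⟨b 0, b 1, hb, (eq_of_le_of_finrank_eq ?_ ?_).symm⟩
  · rw [span_le]
    rintro _ (rfl | rfl)
    exacts [(b 0).2, (b 1).2]
  · rw [finrank_span_pair_of_linearIndependent hb, h]

theorem exists_le_finrank_eq {V : Type*} [AddCommGroup V] [Module ℂ V] [FiniteDimensional ℂ V]
    (k : ℕ) (S : Submodule ℂ V) (h : finrank ℂ S + k ≤ finrank ℂ V) :
    ∃ W, S ≤ W ∧ finrank ℂ W = finrank ℂ S + k := by
  induction k with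
  | zero => exact ⟨S, le_rfl, rfl⟩
  | succ k ih =>
    obtain ⟨W, hSW, hW⟩ := ih (by omega)
    obtain ⟨v, hv⟩ := W.exists_of_finrank_lt (by omega)
    have hv' : v ∉ W := by simpa using hv 1 one_ne_zero
    exact ⟨W ⊔ ℂ ∙ v, hSW.trans le_sup_left, by rw [finrank_sup_span_singleton hv', hW]; rfl⟩

/-! ### Cameras -/

namespace Camera

variable (C : Camera)

/-- A vector representing the camera center. -/
def ctr : Fin 4 → ℂ := C.center.rep

/-- The back-projection `ℓ ↦ Cᵀ ℓ` sending an image line to a plane through the center. -/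
def back : (Fin 3 → ℂ) →ₗ[ℂ] (Fin 4 → ℂ) := C.mat.transpose.mulVecLin

theorem ctr_ne_zero : C.ctr ≠ 0 := C.center.rep_nonzero

theorem submodule_center : C.center.submodule = ℂ ∙ C.ctr := C.center.submodule_eq

theorem ker_lin : LinearMap.ker C.lin = ℂ ∙ C.ctr := by
  rw [← submodule_center, center, Projectivization.submodule_mk'']

theorem lin_ctr : C.lin C.ctr = 0 := by
  have : C.ctr ∈ LinearMap.ker C.lin := by
    rw [ker_lin]
    exact mem_span_singleton_self _
  exact this

theorem back_dotProduct (l : Fin 3 → ℂ) (v : Fin 4 → ℂ) : C.back l ⬝ᵥ v = l ⬝ᵥ C.lin v := by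
  simp only [back, lin, Matrix.mulVecLin_apply]
  rw [Matrix.mulVec_transpose, Matrix.dotProduct_mulVec]

theorem back_dotProduct_ctr (l : Fin 3 → ℂ) : C.back l ⬝ᵥ C.ctr = 0 := by
  rw [back_dotProduct, lin_ctr, dotProduct_zero]

theorem finrank_range_back : finrank ℂ (LinearMap.range C.back) = 3 :=
  (C.mat.rank_transpose).trans C.full_rank

theorem ker_back : LinearMap.ker C.back = ⊥ := by
  have h := LinearMap.finrank_range_add_finrank_ker C.back
  rw [finrank_range_back, finrank_fin_fun] at h
  exact finrank_eq_zero.mp (by omega)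

theorem back_injective : Function.Injective C.back := LinearMap.ker_eq_bot.mp C.ker_back

theorem range_back : LinearMap.range C.back = perp (ℂ ∙ C.ctr) := by
  refine eq_of_le_of_finrank_eq ?_ ?_
  · rintro _ ⟨l, rfl⟩
    exact mem_perp_span_singleton.mpr (C.back_dotProduct_ctr l)
  · rw [finrank_range_back, finrank_perp, finrank_span_singleton C.ctr_ne_zero]

/-- A linear left inverse of the back-projection. -/
def inv : (Fin 4 → ℂ) →ₗ[ℂ] (Fin 3 → ℂ) :=
  (C.back.exists_leftInverse_of_injective C.ker_back).choose

@[simp]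
theorem inv_back (l : Fin 3 → ℂ) : C.inv (C.back l) = l :=
  LinearMap.congr_fun (C.back.exists_leftInverse_of_injective C.ker_back).choose_spec l

theorem back_inv {h : Fin 4 → ℂ} (hh : h ⬝ᵥ C.ctr = 0) : C.back (C.inv h) = h := by
  have : h ∈ LinearMap.range C.back := by
    rw [range_back]
    exact mem_perp_span_singleton.mpr hh
  obtain ⟨l, rfl⟩ := this
  rw [inv_back]

theorem inv_ne_zero {h : Fin 4 → ℂ} (hh : h ⬝ᵥ C.ctr = 0) (h0 : h ≠ 0) : C.inv h ≠ 0 := by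
  intro hc
  have := C.back_inv hh
  rw [hc, map_zero] at this
  exact h0 this.symm

theorem back_rep_ne_zero (l : ℙ ℂ (Fin 3 → ℂ)) : C.back l.rep ≠ 0 :=
  fun h => l.rep_nonzero (C.back_injective (h.trans (map_zero _).symm))

theorem contains_center_iff (L : LineP3) : L.Contains C.center ↔ C.ctr ∈ L.1 := by
  rw [LineP3.Contains, submodule_center, span_singleton_le_iff_mem]

/-- Off the center the camera is injective on `L`, so the image is two-dimensional and an inclusion
in the orthogonal complement of `ℓ` is already an equality. -/
theorem isImage_iff {L : LineP3} (hL : C.ctr ∉ L.1) (l : ℙ ℂ (Fin 3 → ℂ)) :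
    C.IsImage L l ↔ ∀ v ∈ L.1, C.back l.rep ⬝ᵥ v = 0 := by
  constructor
  · intro h v hv
    rw [back_dotProduct, dotProduct_comm]
    exact (h _).mpr (mem_map_of_mem hv)
  · intro h
    have hle : L.1.map C.lin ≤ perp (ℂ ∙ l.rep) := by
      rintro _ ⟨v, hv, rfl⟩
      rw [mem_perp_span_singleton, dotProduct_comm, ← back_dotProduct]
      exact h v hv
    have hdisj : Disjoint L.1 (LinearMap.ker C.lin) := by
      rw [ker_lin, disjoint_span_singleton' C.ctr_ne_zero]
      exact hL
    have heq : L.1.map C.lin = perp (ℂ ∙ l.rep) := by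
      refine eq_of_le_of_finrank_eq hle ?_
      rw [finrank_perp, finrank_span_singleton l.rep_nonzero]
      have hinj : Function.Injective (C.lin.domRestrict L.1) := by
        rw [← LinearMap.ker_eq_bot, LinearMap.ker_domRestrict]
        rw [disjoint_iff] at hdisj
        rw [eq_bot_iff]
        intro x hx
        have : (x : Fin 4 → ℂ) ∈ L.1 ⊓ LinearMap.ker C.lin := ⟨x.2, hx⟩
        rw [hdisj] at this
        simpa using this
      have := LinearMap.finrank_range_of_inj hinj
      rw [LinearMap.range_domRestrict, L.2] at this
      exact this
    intro x
    rw [heq, mem_perp_span_singleton]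

end Camera

/-! ### Joint image and determinantal variety in terms of back-projected planes -/

/-- The plane spanned by the line `w₁ = w₂ = 0` and the point `c`. -/
def join (w₁ w₂ c : Fin 4 → ℂ) : Fin 4 → ℂ := (w₂ ⬝ᵥ c) • w₁ - (w₁ ⬝ᵥ c) • w₂

theorem join_dotProduct (w₁ w₂ c : Fin 4 → ℂ) : join w₁ w₂ c ⬝ᵥ c = 0 := by
  simp [join, sub_dotProduct, mul_comm]

theorem join_mem_span (w₁ w₂ c : Fin 4 → ℂ) : join w₁ w₂ c ∈ span ℂ {w₁, w₂} :=
  sub_mem (smul_mem _ _ (subset_span (by simp))) (smul_mem _ _ (subset_span (by simp)))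

/-- When `c` is off the base line, passing through `c` is one nontrivial linear condition on the
pencil, so a single member satisfies it. -/
theorem exists_smul_eq_join {w₁ w₂ c h : Fin 4 → ℂ} (hh : h ∈ span ℂ {w₁, w₂}) (h0 : h ≠ 0)
    (hc : h ⬝ᵥ c = 0) (hw : ¬ (w₁ ⬝ᵥ c = 0 ∧ w₂ ⬝ᵥ c = 0)) :
    ∃ r : ℂ, r ≠ 0 ∧ join w₁ w₂ c = r • h := by
  obtain ⟨x, y, rfl⟩ := mem_span_pair.mp hh
  simp only [add_dotProduct, smul_dotProduct, smul_eq_mul] at hc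
  unfold join
  by_cases hq : w₂ ⬝ᵥ c = 0
  · have hp : w₁ ⬝ᵥ c ≠ 0 := fun h => hw ⟨h, hq⟩
    have hx : x = 0 := by simpa [hq, hp] using hc
    have hy : y ≠ 0 := by
      rintro rfl
      simp [hx] at h0
    refine ⟨-(w₁ ⬝ᵥ c) / y, by simp [hp, hy], ?_⟩
    rw [hq, hx, zero_smul, zero_sub, zero_add, smul_smul, div_mul_cancel₀ _ hy, neg_smul]
  · have hx : x ≠ 0 := by
      rintro rfl
      have hy : y = 0 := by simpa [hq] using hc
      simp [hy] at h0
    refine ⟨(w₂ ⬝ᵥ c) / x, by simp [hq, hx], ?_⟩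
    rw [smul_add, smul_smul, smul_smul, div_mul_cancel₀ _ hx, sub_eq_add_neg, ← neg_smul]
    congr 2
    field_simp
    linear_combination -hc

theorem linearIndependent_of_join_ne_zero {w₁ w₂ c : Fin 4 → ℂ} (h : join w₁ w₂ c ≠ 0) :
    LinearIndependent ℂ ![w₁, w₂] := by
  rw [LinearIndependent.pair_iff]
  by_contra! hc
  obtain ⟨s, t, hst, hne⟩ := hc
  apply h
  have h1 : s * (w₁ ⬝ᵥ c) + t * (w₂ ⬝ᵥ c) = 0 := by
    rw [← smul_eq_mul, ← smul_eq_mul, ← smul_dotProduct, ← smul_dotProduct, ← add_dotProduct, hst,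
      zero_dotProduct]
  have h2 (k) : s * w₁ k + t * w₂ k = 0 := by simpa using congrFun hst k
  ext k
  simp only [join, Pi.sub_apply, Pi.smul_apply, smul_eq_mul, Pi.zero_apply]
  by_cases hs : s = 0
  · have ht := hne hs
    simp only [hs, zero_mul, zero_add, mul_eq_zero, ht, false_or] at h1 h2
    simp [h1, h2]
  · refine mul_left_cancel₀ hs ?_
    linear_combination (w₂ ⬝ᵥ c) * h2 k - w₂ k * h1

variable (C : Fin m → Camera)

/-- Homogeneous coordinates of the images of the line `w₁ = w₂ = 0`. -/
def imageCoords (w₁ w₂ : Fin 4 → ℂ) (i : Fin m) : Fin 3 → ℂ :=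
  (C i).inv (join w₁ w₂ (C i).ctr)

theorem back_imageCoords (w₁ w₂ : Fin 4 → ℂ) (i : Fin m) :
    (C i).back (imageCoords C w₁ w₂ i) = join w₁ w₂ (C i).ctr :=
  (C i).back_inv (join_dotProduct _ _ _)

theorem imageCoords_ne_zero_iff {w₁ w₂ : Fin 4 → ℂ} {i : Fin m} :
    imageCoords C w₁ w₂ i ≠ 0 ↔ join w₁ w₂ (C i).ctr ≠ 0 := by
  rw [← back_imageCoords, ne_eq, ne_eq, map_eq_zero_iff _ (C i).back_injective]

theorem back_rep_pt (x : Fin m → Fin 3 → ℂ) (hx : ∀ i, x i ≠ 0) :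
    ∃ r : Fin m → ℂ, (∀ i, r i ≠ 0) ∧
      ∀ i, (C i).back (pt x hx i).rep = r i • (C i).back (x i) := by
  obtain ⟨r, hr, h⟩ := exists_rep_pt x hx
  exact ⟨r, hr, fun i => by rw [h, map_smul]⟩

/-- The column space is enlarged to dimension exactly 2, so that a base line exists even when all
planes coincide. -/
theorem mem_determinantalVariety_iff_exists {l : P2Pow m} :
    l ∈ determinantalVariety C ↔
      ∃ w₁ w₂, LinearIndependent ℂ ![w₁, w₂] ∧ ∀ i, (C i).back (l i).rep ∈ span ℂ {w₁, w₂} := by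
  have hrank : (backProjectionMatrix C l).rank =
      finrank ℂ (span ℂ (Set.range fun i => (C i).back (l i).rep)) := by
    rw [Matrix.rank_eq_finrank_span_cols]
    rfl
  rw [determinantalVariety, Set.mem_ofPred_eq, hrank]
  constructor
  · intro h
    set S := span ℂ (Set.range fun i => (C i).back (l i).rep) with hS
    obtain ⟨W, hW, hW2⟩ := exists_le_finrank_eq (2 - finrank ℂ S) S
      (by rw [finrank_fin_fun]; omega)
    obtain ⟨w₁, w₂, hw, rfl⟩ := exists_linearIndependent_pair_span (W := W) (by omega)
    exact ⟨w₁, w₂, hw, fun i => hW (subset_span ⟨i, rfl⟩)⟩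
  · rintro ⟨w₁, w₂, hw, h⟩
    rw [← finrank_span_pair_of_linearIndependent hw]
    refine finrank_mono (span_le.mpr ?_)
    rintro _ ⟨i, rfl⟩
    exact h i

/-- Here `w₁, w₂` are equations of the line. Compared with `mem_determinantalVariety_iff_exists`,
the only extra condition is that the base line avoids the centers. -/
theorem mem_jointImage_iff {l : P2Pow m} :
    l ∈ jointImage C ↔ ∃ w₁ w₂, LinearIndependent ℂ ![w₁, w₂] ∧
      (∀ i, ¬ (w₁ ⬝ᵥ (C i).ctr = 0 ∧ w₂ ⬝ᵥ (C i).ctr = 0)) ∧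
      ∀ i, (C i).back (l i).rep ∈ span ℂ {w₁, w₂} := by
  constructor
  · rintro ⟨L, hL, hl⟩
    obtain ⟨w₁, w₂, hw, hLw⟩ := exists_linearIndependent_pair_span (W := perp L.1)
      (by rw [finrank_perp, L.2])
    have hL' : L.1 = perp (span ℂ {w₁, w₂}) := by rw [← hLw, perp_perp]
    simp only [(C _).contains_center_iff] at hL
    refine ⟨w₁, w₂, hw, fun i => ?_, fun i => ?_⟩
    · rw [← mem_perp_span_pair, ← hL']
      exact hL i
    · rw [← hLw, mem_perp]
      intro v hv
      rw [dotProduct_comm]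
      exact ((C i).isImage_iff (hL i) _).mp (hl i) v hv
  · rintro ⟨w₁, w₂, hw, hc, hl⟩
    have h2 : finrank ℂ (perp (span ℂ {w₁, w₂})) = 2 := by
      rw [finrank_perp, finrank_span_pair_of_linearIndependent hw]
    have hL (i) : (C i).ctr ∉ perp (span ℂ {w₁, w₂}) := by
      rw [mem_perp_span_pair]
      exact hc i
    refine ⟨⟨perp (span ℂ {w₁, w₂}), h2⟩, fun i => ?_, fun i => ?_⟩
    · rw [Camera.contains_center_iff]
      exact hL i
    · rw [Camera.isImage_iff _ (hL i)]
      intro v hv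
      exact mem_perp.mp hv _ (hl i)

/-- The joint image is parametrised by pairs of linear forms. -/
theorem mem_jointImage_iff_exists_imageCoords [NeZero m] {l : P2Pow m} :
    l ∈ jointImage C ↔ ∃ w₁ w₂, ∃ h : ∀ i, imageCoords C w₁ w₂ i ≠ 0,
      pt (imageCoords C w₁ w₂) h = l := by
  rw [mem_jointImage_iff]
  constructor
  · rintro ⟨w₁, w₂, hw, hc, hl⟩
    have key (i) := exists_smul_eq_join (hl i) ((C i).back_rep_ne_zero _)
      ((C i).back_dotProduct_ctr _) (hc i)
    refine ⟨w₁, w₂, fun i => ?_, ?_⟩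
    · obtain ⟨r, hr, h⟩ := key i
      rw [imageCoords_ne_zero_iff, h]
      exact smul_ne_zero hr ((C i).back_rep_ne_zero _)
    · refine Eq.trans ?_ (pt_rep l)
      refine pt_eq_of_smul _ _ fun i => ?_
      obtain ⟨r, hr, h⟩ := key i
      refine ⟨r, (C i).back_injective ?_⟩
      rw [map_smul, back_imageCoords, h]
  · rintro ⟨w₁, w₂, h, rfl⟩
    have hj (i) := (imageCoords_ne_zero_iff C).mp (h i)
    refine ⟨w₁, w₂, linearIndependent_of_join_ne_zero (hj 0), ?_, ?_⟩
    · rintro i ⟨h1, h2⟩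
      exact hj i (by simp [join, h1, h2])
    · obtain ⟨r, -, hr⟩ := back_rep_pt C _ h
      intro i
      rw [hr, back_imageCoords]
      exact smul_mem _ _ (join_mem_span _ _ _)

theorem jointImage_subset_determinantalVariety : jointImage C ⊆ determinantalVariety C := by
  intro l hl
  obtain ⟨w₁, w₂, hw, -, h⟩ := (mem_jointImage_iff C).mp hl
  exact (mem_determinantalVariety_iff_exists C).mpr ⟨w₁, w₂, hw, h⟩

end LineMultiview

end

noncomputable section

namespace LineMultiview

open Module Submodule

variable {m n : ℕ} {σ : Type*}

/-! ### Polynomial families of vectors -/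

/-- A family of vectors with polynomial entries. -/
def IsPolyVec {ι : Type*} (w : (σ → ℂ) → ι → ℂ) : Prop := ∀ k, (fun a => w a k) ∈ polyFun σ

theorem IsPolyVec.const {ι : Type*} (v : ι → ℂ) : IsPolyVec fun _ : σ → ℂ => v :=
  fun k => const_mem_polyFun (v k)

theorem IsPolyVec.add {ι : Type*} {v w : (σ → ℂ) → ι → ℂ} (hv : IsPolyVec v) (hw : IsPolyVec w) :
    IsPolyVec fun a => v a + w a := fun k => add_mem (hv k) (hw k)

theorem IsPolyVec.sub {ι : Type*} {v w : (σ → ℂ) → ι → ℂ} (hv : IsPolyVec v) (hw : IsPolyVec w) :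
    IsPolyVec fun a => v a - w a := fun k => sub_mem (hv k) (hw k)

theorem IsPolyVec.smul {ι : Type*} {f : (σ → ℂ) → ℂ} {w : (σ → ℂ) → ι → ℂ} (hf : f ∈ polyFun σ)
    (hw : IsPolyVec w) : IsPolyVec fun a => f a • w a := fun k => mul_mem hf (hw k)

theorem IsPolyVec.dotProduct_const {ι : Type*} [Fintype ι] {w : (σ → ℂ) → ι → ℂ}
    (hw : IsPolyVec w) (c : ι → ℂ) : (fun a => w a ⬝ᵥ c) ∈ polyFun σ := by
  have : (fun a => w a ⬝ᵥ c) = ∑ k, (fun a => w a k) * fun _ => c k := by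
    ext a
    simp [dotProduct]
  rw [this]
  exact sum_mem fun k _ => mul_mem (hw k) (const_mem_polyFun _)

theorem IsPolyVec.map {k : ℕ} {w : (σ → ℂ) → Fin n → ℂ} (hw : IsPolyVec w)
    (f : (Fin n → ℂ) →ₗ[ℂ] (Fin k → ℂ)) : IsPolyVec fun a => f (w a) := by
  intro j
  have : (fun a => f (w a) j) = fun a => w a ⬝ᵥ fun i => f (Pi.single i 1) j := by
    ext a
    rw [LinearMap.pi_apply_eq_sum_univ f (w a)]
    simp only [dotProduct, Finset.sum_apply, Pi.smul_apply, smul_eq_mul]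
    refine Finset.sum_congr rfl fun i _ => ?_
    have : (fun j => if i = j then (1 : ℂ) else 0) = Pi.single i 1 := by
      ext j
      simp [Pi.single_apply, eq_comm]
    rw [this]
  rw [this]
  exact hw.dotProduct_const _

theorem IsPolyVec.join {w₁ w₂ : (σ → ℂ) → Fin 4 → ℂ} (h₁ : IsPolyVec w₁) (h₂ : IsPolyVec w₂)
    (c : Fin 4 → ℂ) : IsPolyVec fun a => join (w₁ a) (w₂ a) c :=
  (h₁.smul (h₂.dotProduct_const c)).sub (h₂.smul (h₁.dotProduct_const c))

theorem isPolyFamily_imageCoords (C : Fin m → Camera) {w₁ w₂ : (σ → ℂ) → Fin 4 → ℂ}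
    (h₁ : IsPolyVec w₁) (h₂ : IsPolyVec w₂) :
    IsPolyFamily fun a => imageCoords C (w₁ a) (w₂ a) :=
  fun i => (h₁.join h₂ (C i).ctr).map (C i).inv

variable (C : Fin m → Camera)

/-- The universal family of images of lines, parametrised by pairs of linear forms. -/
def jointFamily (a : Fin 2 × Fin 4 → ℂ) : Fin m → Fin 3 → ℂ :=
  imageCoords C (fun k => a (0, k)) fun k => a (1, k)

theorem isPolyFamily_jointFamily : IsPolyFamily (jointFamily C) :=
  isPolyFamily_imageCoords C (fun k => coord_mem_polyFun (0, k)) (fun k => coord_mem_polyFun (1, k))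

theorem jointFamily_apply (w₁ w₂ : Fin 4 → ℂ) :
    jointFamily C (fun p => ![w₁, w₂] p.1 p.2) = imageCoords C w₁ w₂ := rfl

theorem locus_jointFamily [NeZero m] : locus (jointFamily C) = jointImage C := by
  ext l
  rw [mem_jointImage_iff_exists_imageCoords]
  constructor
  · rintro ⟨a, h, rfl⟩
    exact ⟨_, _, h, rfl⟩
  · rintro ⟨w₁, w₂, h, rfl⟩
    exact ⟨fun p => ![w₁, w₂] p.1 p.2, h, rfl⟩

theorem exists_dotProduct_eq {u w : Fin n → ℂ} (h : LinearIndependent ℂ ![u, w]) (p q : ℂ) :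
    ∃ a, u ⬝ᵥ a = p ∧ w ⬝ᵥ a = q := by
  have key : ∀ {u w : Fin n → ℂ}, LinearIndependent ℂ ![u, w] → ∃ a, u ⬝ᵥ a = 1 ∧ w ⬝ᵥ a = 0 := by
    intro u w h
    have hle : ¬ perp (ℂ ∙ w) ≤ perp (ℂ ∙ u) := by
      intro hle
      have hu : u ∈ perp (perp (ℂ ∙ w)) := by
        rw [mem_perp]
        intro v hv
        exact mem_perp_span_singleton.mp (hle hv)
      rw [perp_perp, mem_span_singleton] at hu
      obtain ⟨r, hr⟩ := hu
      have := LinearIndependent.pair_iff.mp h 1 (-r) (by rw [← hr]; simp)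
      exact one_ne_zero this.1
    obtain ⟨v, hv, hvu⟩ := SetLike.not_le_iff_exists.mp hle
    rw [mem_perp_span_singleton, dotProduct_comm] at hv hvu
    exact ⟨(u ⬝ᵥ v)⁻¹ • v, by simp [hvu], by simp [hv]⟩
  obtain ⟨a, ha⟩ := key h
  obtain ⟨b, hb⟩ := key (LinearIndependent.pair_symm_iff.mp h)
  exact ⟨p • a + q • b, by simp [ha, hb], by simp [ha, hb]⟩

theorem exists_dotProduct_eq_one {u : Fin n → ℂ} (h : u ≠ 0) : ∃ a, u ⬝ᵥ a = 1 := by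
  obtain ⟨a, ha⟩ : ∃ a, u ⬝ᵥ a ≠ 0 := by
    by_contra! hc
    exact h (dotProduct_eq_zero u hc)
  exact ⟨(u ⬝ᵥ a)⁻¹ • a, by simp [ha]⟩

/-- Every plane through a camera center arises as a back-projected image line. -/
theorem exists_join_eq {c h : Fin 4 → ℂ} (hc : c ≠ 0) (hh : h ⬝ᵥ c = 0) :
    ∃ w₁ w₂, join w₁ w₂ c = h := by
  obtain ⟨a, ha⟩ := exists_dotProduct_eq_one hc
  exact ⟨h, a, by simp [join, hh, dotProduct_comm a c, ha]⟩

theorem exists_jointFamily_eq (i : Fin m) (l : Fin 3 → ℂ) : ∃ a, jointFamily C a i = l := by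
  obtain ⟨w₁, w₂, h⟩ := exists_join_eq (C i).ctr_ne_zero ((C i).back_dotProduct_ctr l)
  refine ⟨fun p => ![w₁, w₂] p.1 p.2, ?_⟩
  rw [jointFamily_apply, imageCoords, h, Camera.inv_back]

theorem exists_jointFamily_ne_zero (i : Fin m) : ∃ a, jointFamily C a i ≠ 0 := by
  obtain ⟨a, ha⟩ := exists_jointFamily_eq C i (Pi.single 0 1)
  exact ⟨a, by rw [ha]; simp⟩

theorem jointImage_nonempty [NeZero m] : (jointImage C).Nonempty := by
  rw [← locus_jointFamily]
  obtain ⟨a, ha, -⟩ := (isPolyFamily_jointFamily C).exists_generic (exists_jointFamily_ne_zero C)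
    (ι := Empty) (f := Empty.elim) (fun i => i.elim) (fun i => i.elim)
  exact ⟨_, a, ha, rfl⟩

theorem isPreirreducible_jointImage [NeZero m] : IsPreirreducible (jointImage C) := by
  rw [← locus_jointFamily]
  exact (isPolyFamily_jointFamily C).isPreirreducible_locus

/-! ### The determinantal variety is closed -/

theorem isWeightedHomogeneous_det {τ M ι : Type*} [AddCommMonoid M] [Fintype ι] [DecidableEq ι]
    {w : τ → M} {A : Matrix ι ι (MvPolynomial τ ℂ)} {d : ι → M}
    (h : ∀ i j, MvPolynomial.IsWeightedHomogeneous w (A i j) (d i)) :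
    MvPolynomial.IsWeightedHomogeneous w A.det (∑ i, d i) := by
  rw [Matrix.det_apply]
  refine MvPolynomial.IsWeightedHomogeneous.sum _ _ _ fun s _ => ?_
  have hs : ∑ i, d i = ∑ i, d (s i) := (Equiv.sum_comp s d).symm
  rw [hs]
  have : MvPolynomial.IsWeightedHomogeneous w (∏ i, A (s i) i) (∑ i, d (s i)) :=
    MvPolynomial.IsWeightedHomogeneous.prod _ _ _ fun i _ => h _ _
  rcases Int.units_eq_one_or (Equiv.Perm.sign s) with h | h
  · rwa [h, one_smul]
  · rw [h, Units.neg_smul, one_smul]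
    exact (MvPolynomial.weightedHomogeneousSubmodule ℂ w (∑ i, d (s i))).neg_mem this

/-- Three vectors of ℂ⁴ are dependent exactly when no fourth vector completes them to a basis; the
auxiliary row `u` turns the rank condition into square determinants. -/
theorem mem_determinantalVariety_iff_det {l : P2Pow m} :
    l ∈ determinantalVariety C ↔ ∀ (e : Fin 3 → Fin m) (u : Fin 4 → ℂ),
      (Matrix.of (Fin.snoc (fun r => (C (e r)).back (l (e r)).rep) u : Fin 4 → Fin 4 → ℂ)).det
        = 0 := by
  constructor
  · intro hl e u
    obtain ⟨w₁, w₂, hw, h⟩ := (mem_determinantalVariety_iff_exists C).mp hl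
    by_contra hdet
    have hli := Matrix.linearIndependent_rows_iff_isUnit.mpr
      ((Matrix.isUnit_iff_isUnit_det _).mpr (isUnit_iff_ne_zero.mpr hdet))
    have hli3 : LinearIndependent ℂ (fun r => (C (e r)).back (l (e r)).rep) := by
      have := hli.comp (Fin.castSucc : Fin 3 → Fin 4) (Fin.castSucc_injective 3)
      have hrow : (Matrix.of (Fin.snoc (fun r => (C (e r)).back (l (e r)).rep) u :
          Fin 4 → Fin 4 → ℂ)).row ∘ Fin.castSucc = fun r => (C (e r)).back (l (e r)).rep := by
        funext r
        exact Fin.snoc_castSucc (α := fun _ => Fin 4 → ℂ) u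
          (fun r => (C (e r)).back (l (e r)).rep) r
      rwa [hrow] at this
    have h1 := finrank_span_eq_card hli3
    have h2 : span ℂ (Set.range fun r => (C (e r)).back (l (e r)).rep) ≤ span ℂ {w₁, w₂} := by
      rw [span_le]
      rintro _ ⟨r, rfl⟩
      exact h (e r)
    have h3 := finrank_mono h2
    rw [h1, finrank_span_pair_of_linearIndependent hw] at h3
    simp at h3
  · intro h
    rw [determinantalVariety, Set.mem_ofPred_eq, Matrix.rank_eq_finrank_span_cols]
    by_contra! hlt
    obtain ⟨κ, a, ha, hspan, hli⟩ := exists_linearIndependent' ℂ (backProjectionMatrix C l).col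
    have : Finite κ := Finite.of_injective a ha
    cases nonempty_fintype κ
    rw [← hspan, finrank_span_eq_card hli] at hlt
    obtain ⟨g⟩ : Nonempty (Fin 3 ↪ κ) :=
      Function.Embedding.nonempty_of_card_le (by simp only [Fintype.card_fin]; omega)
    have hli3 := hli.comp g g.injective
    obtain ⟨u, hu⟩ := exists_linearIndependent_snoc_of_lt_finrank hli3 (by simp)
    have := Matrix.linearIndependent_rows_iff_isUnit.mp
      (show LinearIndependent ℂ (Matrix.of (Fin.snoc _ u : Fin 4 → Fin 4 → ℂ)).row from hu)
    rw [Matrix.isUnit_iff_isUnit_det, isUnit_iff_ne_zero] at this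
    exact this (h (a ∘ g) u)

theorem isClosed_determinantalVariety : IsClosed (determinantalVariety C) := by
  let A (e : Fin 3 → Fin m) (u : Fin 4 → ℂ) : Matrix (Fin 4) (Fin 4) (CoordRing m) :=
    Matrix.of (Fin.snoc (fun r k => linForm (e r) ((C (e r)).lin (Pi.single k 1)))
      (fun k => MvPolynomial.C (u k)) : Fin 4 → Fin 4 → CoordRing m)
  have hA (e u) : IsMultihomogeneous (A e u).det := by
    refine ⟨_, isWeightedHomogeneous_det
      (d := (Fin.snoc (fun r => Pi.single (e r) 1) 0 : Fin 4 → Fin m → ℕ)) fun i k => ?_⟩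
    refine Fin.lastCases ?_ (fun r => ?_) i
    · simp only [A, Matrix.of_apply, Fin.snoc_last]
      exact MvPolynomial.isWeightedHomogeneous_C _ _
    · simpa [A] using linForm_isWeightedHomogeneous _ _
  have heval (e u) (l : P2Pow m) : MvPolynomial.eval (coords l) (A e u).det =
      (Matrix.of (Fin.snoc (fun r => (C (e r)).back (l (e r)).rep) u : Fin 4 → Fin 4 → ℂ)).det := by
    rw [RingHom.map_det]
    congr 1
    ext i k
    refine Fin.lastCases ?_ (fun r => ?_) i
    · simp only [A, RingHom.mapMatrix_apply, Matrix.map_apply, Matrix.of_apply, Fin.snoc_last,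
        MvPolynomial.eval_C]
    · have h : (C (e r)).back (l (e r)).rep k =
          (C (e r)).back (l (e r)).rep ⬝ᵥ Pi.single k 1 := by simp
      simp only [A, RingHom.mapMatrix_apply, Matrix.map_apply, Matrix.of_apply, Fin.snoc_castSucc,
        eval_linForm]
      rw [h, Camera.back_dotProduct]
      rfl
  have : determinantalVariety C =
      ⋂ (e : Fin 3 → Fin m) (u : Fin 4 → ℂ), {l | MvPolynomial.eval (coords l) (A e u).det = 0} := by
    ext l
    rw [mem_determinantalVariety_iff_det]
    simp only [heval, Set.mem_iInter, Set.mem_ofPred_eq]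
  rw [this]
  exact isClosed_iInter fun e => isClosed_iInter fun u => isClosed_zeroLocus (hA e u)

/-! ### The joint image contains a nonempty open subset of the determinantal variety -/

theorem linearIndependent_ctr (hC : Function.Injective fun i => (C i).center) {i j : Fin m}
    (hij : i ≠ j) : LinearIndependent ℂ ![(C i).ctr, (C j).ctr] :=
  Projectivization.linearIndependent_pair_iff_ne.mpr (hC.ne hij)

theorem exists_join_dotProduct_ne_zero {c c' : Fin 4 → ℂ} (h : LinearIndependent ℂ ![c, c']) :
    ∃ w₁ w₂, join w₁ w₂ c ⬝ᵥ c' ≠ 0 := by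
  obtain ⟨a, ha, ha'⟩ := exists_dotProduct_eq h 0 1
  obtain ⟨b, hb, hb'⟩ := exists_dotProduct_eq h 1 0
  refine ⟨a, b, ?_⟩
  rw [dotProduct_comm] at ha ha' hb hb'
  simp [join, ha, ha', hb]

/-- The open set asks that each center be missed by some plane `Hⱼ`; no base line of the pencil can
then contain that center. -/
theorem exists_isOpen_inter_subset_jointImage (hm : 2 ≤ m)
    (hC : Function.Injective fun i => (C i).center) :
    ∃ U : Set (P2Pow m), IsOpen U ∧ determinantalVariety C ∩ U ⊆ jointImage C ∧
      (determinantalVariety C ∩ U).Nonempty := by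
  have : NeZero m := ⟨by omega⟩
  refine ⟨⋂ i, ⋃ j, {l | (l j).rep ⬝ᵥ (C j).lin (C i).ctr ≠ 0},
    isOpen_iInter_of_finite fun i => isOpen_iUnion fun j => isOpen_linForm_ne_zero j _, ?_, ?_⟩
  · intro l
    simp only [Set.mem_inter_iff, Set.mem_iInter, Set.mem_iUnion, Set.mem_ofPred_eq,
      ← Camera.back_dotProduct]
    rw [mem_determinantalVariety_iff_exists, mem_jointImage_iff]
    rintro ⟨⟨w₁, w₂, hw, h⟩, hne⟩
    refine ⟨w₁, w₂, hw, fun i hi => ?_, h⟩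
    obtain ⟨j, hj⟩ := hne i
    obtain ⟨x, y, hxy⟩ := mem_span_pair.mp (h j)
    apply hj
    rw [← hxy]
    simp [add_dotProduct, hi]
  · have : Nontrivial (Fin m) := Fin.nontrivial_iff_two_le.mpr hm
    -- The plane `Hᵢ` always contains its own center, so the witness must come from a different
    -- camera.
    choose p hp using fun i : Fin m => exists_ne i
    obtain ⟨a, ha, ha'⟩ := (isPolyFamily_jointFamily C).exists_generic
      (exists_jointFamily_ne_zero C)
      (f := fun (i : Fin m) a => (C (p i)).back (jointFamily C a (p i)) ⬝ᵥ (C i).ctr)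
      (fun i => (IsPolyVec.map (isPolyFamily_jointFamily C (p i)) _).dotProduct_const _)
      (fun i => by
        obtain ⟨w₁, w₂, h⟩ := exists_join_dotProduct_ne_zero
          (linearIndependent_ctr C hC (hp i))
        refine ⟨fun p => ![w₁, w₂] p.1 p.2, ?_⟩
        rwa [jointFamily_apply, back_imageCoords])
    refine ⟨pt _ ha, jointImage_subset_determinantalVariety C ?_, ?_⟩
    · rw [← locus_jointFamily]
      exact ⟨a, ha, rfl⟩
    · simp only [Set.mem_iInter, Set.mem_iUnion, Set.mem_ofPred_eq, ← Camera.back_dotProduct]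
      intro i
      obtain ⟨r, hr, h⟩ := back_rep_pt C _ ha
      exact ⟨p i, by rw [h, smul_dotProduct]; exact smul_ne_zero (hr _) (ha' i)⟩

theorem determinantalVariety_subset_of_isIrreducible (hm : 2 ≤ m)
    (hC : Function.Injective fun i => (C i).center)
    (hV : IsIrreducible (determinantalVariety C)) :
    determinantalVariety C ⊆ lineMultiviewVariety C := by
  obtain ⟨U, hU, hsub, hne⟩ := exists_isOpen_inter_subset_jointImage C hm hC
  exact (subset_closure_inter_of_isPreirreducible_of_isOpen hV.2 hU hne).trans (closure_mono hsub)

end LineMultiview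

end

noncomputable section

namespace LineMultiview

open Module Submodule

variable {m : ℕ} (C : Fin m → Camera)

/-! ### Four collinear cameras: the cross-ratio constraint -/

theorem smul_add_smul_eq_zero_of_linearIndependent {V : Type*} [AddCommGroup V] [Module ℂ V]
    {e f : V} {s t s' t' : ℂ} (h : LinearIndependent ℂ ![s • e + t • f, s' • e + t' • f]) :
    s * t' - s' * t ≠ 0 := by
  intro h0
  rw [LinearIndependent.pair_iff] at h
  have h1 := h t' (-t) (by
    have : t' • (s • e + t • f) + -t • (s' • e + t' • f) =
        (s * t' - s' * t) • e := by module
    rw [this, h0, zero_smul])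
  have h2 := h s' (-s) (by
    have : s' • (s • e + t • f) + -s • (s' • e + t' • f) =
        (-(s * t' - s' * t)) • f := by module
    rw [this, h0, neg_zero, zero_smul])
  have h3 := h 1 0 (by
    rw [neg_eq_zero.mp h1.2, neg_eq_zero.mp h2.2]
    simp)
  exact one_ne_zero h3.1

/-- The polynomial `det [Hᵢ(u), Hᵢ(v); Hⱼ(u), Hⱼ(v)]` in the back-projected planes `Hᵢ`. -/
def pairDet (u v : Fin 4 → ℂ) (i j : Fin m) : CoordRing m :=
  linForm i ((C i).lin u) * linForm j ((C j).lin v) -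
    linForm i ((C i).lin v) * linForm j ((C j).lin u)

theorem pairDet_isWeightedHomogeneous (u v : Fin 4 → ℂ) (i j : Fin m) :
    MvPolynomial.IsWeightedHomogeneous
      (fun p : Fin m × Fin 3 => (Pi.single p.1 1 : Fin m → ℕ)) (pairDet C u v i j)
      (Pi.single i 1 + Pi.single j 1) :=
  ((linForm_isWeightedHomogeneous _ _).mul (linForm_isWeightedHomogeneous _ _)).sub
    ((linForm_isWeightedHomogeneous _ _).mul (linForm_isWeightedHomogeneous _ _))

theorem eval_pairDet (u v : Fin 4 → ℂ) (i j : Fin m) (l : P2Pow m) :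
    MvPolynomial.eval (coords l) (pairDet C u v i j) =
      ((C i).back (l i).rep ⬝ᵥ u) * ((C j).back (l j).rep ⬝ᵥ v) -
        ((C i).back (l i).rep ⬝ᵥ v) * ((C j).back (l j).rep ⬝ᵥ u) := by
  simp only [pairDet, map_sub, map_mul, eval_linForm, Camera.back_dotProduct]
  rfl

/-- The difference of the two products whose ratio is the cross-ratio of four planes of a pencil,
weighted by prescribed brackets. -/
def crossRatioForm (u v : Fin 4 → ℂ) (e : Fin 4 → Fin m) (p q : ℂ) : CoordRing m :=
  MvPolynomial.C p * (pairDet C u v (e 0) (e 1) * pairDet C u v (e 2) (e 3)) -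
    MvPolynomial.C q * (pairDet C u v (e 0) (e 2) * pairDet C u v (e 1) (e 3))

theorem crossRatioForm_isMultihomogeneous (u v : Fin 4 → ℂ) (e : Fin 4 → Fin m) (p q : ℂ) :
    IsMultihomogeneous (crossRatioForm C u v e p q) := by
  refine ⟨Pi.single (e 0) 1 + Pi.single (e 1) 1 + (Pi.single (e 2) 1 + Pi.single (e 3) 1), ?_⟩
  have h1 := (MvPolynomial.isWeightedHomogeneous_C
    (fun p : Fin m × Fin 3 => (Pi.single p.1 1 : Fin m → ℕ)) p).mul
    ((pairDet_isWeightedHomogeneous C u v (e 0) (e 1)).mul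
      (pairDet_isWeightedHomogeneous C u v (e 2) (e 3)))
  have h2 := (MvPolynomial.isWeightedHomogeneous_C
    (fun p : Fin m × Fin 3 => (Pi.single p.1 1 : Fin m → ℕ)) q).mul
    ((pairDet_isWeightedHomogeneous C u v (e 0) (e 2)).mul
      (pairDet_isWeightedHomogeneous C u v (e 1) (e 3)))
  rw [zero_add] at h1 h2
  rw [add_add_add_comm] at h2
  exact h1.sub h2

theorem exists_mem_span_pair_dotProduct_eq_zero {a b : Fin 4 → ℂ}
    (h : LinearIndependent ℂ ![a, b]) (c : Fin 4 → ℂ) :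
    ∃ g ∈ span ℂ {a, b}, g ≠ 0 ∧ g ⬝ᵥ c = 0 := by
  by_cases hc : a ⬝ᵥ c = 0
  · exact ⟨a, subset_span (by simp), h.ne_zero 0, hc⟩
  · refine ⟨join a b c, join_mem_span _ _ _, fun h0 => hc ?_, join_dotProduct _ _ _⟩
    have := LinearIndependent.pair_iff.mp h (b ⬝ᵥ c) (-(a ⬝ᵥ c))
      (by rw [neg_smul, ← sub_eq_add_neg]; exact h0)
    exact neg_eq_zero.mp this.2

/-- The cross-ratio of the four planes is constant on the joint image but not on the tuples whose
base line is the line through the four centers. -/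
theorem not_subset_of_areCollinear [NeZero m] (hC : Function.Injective fun i => (C i).center)
    {I : Finset (Fin m)} (hI : I.card = 4) (h : AreCollinear C I) :
    ¬ determinantalVariety C ⊆ lineMultiviewVariety C := by
  classical
  let e : Fin 4 → Fin m := fun k => I.orderEmbOfFin hI k
  have he : Function.Injective e := (I.orderEmbOfFin hI).injective
  have heI (k) : e k ∈ I := I.orderEmbOfFin_mem hI k
  set E : Submodule ℂ (Fin 4 → ℂ) := ⨆ i ∈ I, (C i).center.submodule with hE
  have hE2 : finrank ℂ E = 2 := h
  have hcE (k) : (C (e k)).ctr ∈ E := by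
    have : (C (e k)).center.submodule ≤ E := le_iSup₂_of_le (e k) (heI k) le_rfl
    rw [Camera.submodule_center] at this
    exact this (mem_span_singleton_self _)
  obtain ⟨x, y, -, hxy⟩ := exists_linearIndependent_pair_span hE2
  have hst (k) : ∃ s t : ℂ, s • x + t • y = (C (e k)).ctr :=
    mem_span_pair.mp (hxy ▸ hcE k)
  choose s t hst using hst
  have hbr {j k : Fin 4} (hjk : j ≠ k) : s j * t k - s k * t j ≠ 0 := by
    refine smul_add_smul_eq_zero_of_linearIndependent (e := x) (f := y) ?_
    rw [hst, hst]
    exact linearIndependent_ctr C hC (he.ne hjk)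
  obtain ⟨a, b, hab, hperp⟩ := exists_linearIndependent_pair_span (W := perp E)
    (by rw [finrank_perp, hE2])
  -- Pairing with `u` and `v` reads off the coordinates with respect to `a, b`, so `pairDet` becomes
  -- the bracket of two members of the pencil.
  obtain ⟨u, hu⟩ := exists_dotProduct_eq hab 1 0
  obtain ⟨v, hv⟩ := exists_dotProduct_eq hab 0 1
  have hac (k) : a ⬝ᵥ (C (e k)).ctr = 0 ∧ b ⬝ᵥ (C (e k)).ctr = 0 := by
    rw [← mem_perp_span_pair, ← hperp, perp_perp]
    exact hcE k
  choose g hg hg0 hgc using fun i => exists_mem_span_pair_dotProduct_eq_zero hab (C i).ctr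
  -- A degenerate cross-ratio: the planes at the four centers are `a, a, b, b`, and at every other
  -- center any plane of the pencil through it.
  let H : Fin m → Fin 4 → ℂ := fun i =>
    if i = e 0 ∨ i = e 1 then a else if i = e 2 ∨ i = e 3 then b else g i
  have hH0 (i) : H i ≠ 0 := by
    simp only [H]
    split_ifs
    exacts [hab.ne_zero 0, hab.ne_zero 1, hg0 i]
  have hHc (i) : H i ⬝ᵥ (C i).ctr = 0 := by
    simp only [H]
    split_ifs with h1 h2
    · rcases h1 with rfl | rfl
      exacts [(hac 0).1, (hac 1).1]
    · rcases h2 with rfl | rfl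
      exacts [(hac 2).2, (hac 3).2]
    · exact hgc i
  have hHs (i) : H i ∈ span ℂ {a, b} := by
    simp only [H]
    split_ifs
    exacts [subset_span (by simp), subset_span (by simp), hg i]
  have hx0 (i) : (C i).inv (H i) ≠ 0 := (C i).inv_ne_zero (hHc i) (hH0 i)
  obtain ⟨r, hr, hrep⟩ := back_rep_pt C (fun i => (C i).inv (H i)) hx0
  replace hrep (i) : (C i).back (pt (fun i => (C i).inv (H i)) hx0 i).rep = r i • H i := by
    rw [hrep, (C i).back_inv (hHc i)]
  have hHe0 : H (e 0) = a := by simp [H]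
  have hHe1 : H (e 1) = a := by simp [H]
  have hHe2 : H (e 2) = b := by simp [H, he.eq_iff]
  have hHe3 : H (e 3) = b := by simp [H, he.eq_iff]
  -- With brackets of the centers, `p = [02][13]` and `q = [01][23]`, so the form states that planes
  -- and centers have equal cross-ratio.
  let p := (s 0 * t 2 - s 2 * t 0) * (s 1 * t 3 - s 3 * t 1)
  let q := (s 0 * t 1 - s 1 * t 0) * (s 2 * t 3 - s 3 * t 2)
  intro hsub
  have hmem : pt (fun i => (C i).inv (H i)) hx0 ∈ determinantalVariety C := by
    refine (mem_determinantalVariety_iff_exists C).mpr ⟨a, b, hab, fun i => ?_⟩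
    rw [hrep]
    exact smul_mem _ _ (hHs i)
  have hvan := mem_closure_iff_eval.mp (hsub hmem) _
    (crossRatioForm_isMultihomogeneous C u v e p q) (by
      intro l hl
      obtain ⟨w₁, w₂, -, hw, hspan⟩ := (mem_jointImage_iff C).mp hl
      -- `join` is linear in its last argument, so the planes depend on the centers through the same
      -- coordinates `s k, t k`. Every bracket is then that of the centers times one common factor,
      -- up to scaling.
      have key (k) : ∃ ρ : ℂ, (C (e k)).back (l (e k)).rep =
          ρ • (s k • join w₁ w₂ x + t k • join w₁ w₂ y) := by
        obtain ⟨ρ, hρ, h⟩ := exists_smul_eq_join (hspan (e k)) ((C (e k)).back_rep_ne_zero _)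
          ((C (e k)).back_dotProduct_ctr _) (hw (e k))
        refine ⟨ρ⁻¹, ?_⟩
        rw [eq_inv_smul_iff₀ hρ, ← h, ← hst]
        simp only [join, dotProduct_add, dotProduct_smul, smul_eq_mul]
        module
      choose ρ hρ using key
      simp only [crossRatioForm, map_sub, map_mul, MvPolynomial.eval_C, eval_pairDet, hρ,
        smul_dotProduct, add_dotProduct, smul_eq_mul]
      ring)
  simp only [crossRatioForm, map_sub, map_mul, MvPolynomial.eval_C, eval_pairDet, hrep,
    hHe0, hHe1, hHe2, hHe3, smul_dotProduct, hu, hv, smul_eq_mul] at hvan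
  have hq : q ≠ 0 := mul_ne_zero (hbr (by decide)) (hbr (by decide))
  have : q * (r (e 0) * r (e 1) * r (e 2) * r (e 3)) = 0 := by linear_combination -hvan
  simp [hq, hr] at this

/-! ### No four collinear cameras: density of the joint image -/

/-- The pair `(a, b)` is a linear map to ℂ² sending the points `c i` of a line to the points `(x i :
y i)` of ℙ¹. Up to three distinct points can be prescribed; a fourth would be constrained by its
cross-ratio. -/
theorem exists_interpolation {ι : Type*} [DecidableEq ι] {S : Finset ι} (hS : S.card ≤ 3)
    {c : ι → Fin 4 → ℂ} (hc0 : ∀ i, c i ≠ 0)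
    (hc : ∀ i j, i ≠ j → LinearIndependent ℂ ![c i, c j])
    {E : Submodule ℂ (Fin 4 → ℂ)} (hE : finrank ℂ E = 2) (hcE : ∀ i ∈ S, c i ∈ E)
    {x y : ι → ℂ} (hxy : ∀ i ∈ S, ∀ j ∈ S, i ≠ j → x i * y j - x j * y i ≠ 0) :
    ∃ (a b : Fin 4 → ℂ) (r : ι → ℂ), ∀ i ∈ S,
      r i ≠ 0 ∧ a ⬝ᵥ c i = r i * x i ∧ b ⬝ᵥ c i = r i * y i := by
  have hcases : S.card = 0 ∨ S.card = 1 ∨ S.card = 2 ∨ S.card = 3 := by omega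
  rcases hcases with h | h | h | h
  · rw [Finset.card_eq_zero] at h
    exact ⟨0, 0, 0, by simp [h]⟩
  · obtain ⟨i, rfl⟩ := Finset.card_eq_one.mp h
    obtain ⟨u, hu⟩ := exists_dotProduct_eq_one (hc0 i)
    rw [dotProduct_comm] at hu
    exact ⟨x i • u, y i • u, 1, by simp [hu]⟩
  · obtain ⟨i, j, hij, rfl⟩ := Finset.card_eq_two.mp h
    obtain ⟨a, ha, ha'⟩ := exists_dotProduct_eq (hc i j hij) (x i) (x j)
    obtain ⟨b, hb, hb'⟩ := exists_dotProduct_eq (hc i j hij) (y i) (y j)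
    rw [dotProduct_comm] at ha ha' hb hb'
    exact ⟨a, b, 1, by simp [ha, ha', hb, hb']⟩
  · obtain ⟨i, j, k, hij, hik, hjk, rfl⟩ := Finset.card_eq_three.mp h
    have hEs : span ℂ {c i, c j} = E := by
      refine eq_of_le_of_finrank_eq ?_ ?_
      · rw [span_le]
        rintro _ (rfl | rfl)
        exacts [hcE i (by simp), hcE j (by simp)]
      · rw [finrank_span_pair_of_linearIndependent (hc i j hij), hE]
    obtain ⟨α, β, hk⟩ := mem_span_pair.mp (hEs ▸ hcE k (by simp))
    have hα : α ≠ 0 := by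
      rintro rfl
      have := LinearIndependent.pair_iff.mp (hc j k hjk) β (-1) (by rw [← hk]; simp)
      simp at this
    have hβ : β ≠ 0 := by
      rintro rfl
      have := LinearIndependent.pair_iff.mp (hc i k hik) α (-1) (by rw [← hk]; simp)
      simp at this
    have hΔ := hxy i (by simp) j (by simp) hij
    have hγ := hxy k (by simp) j (by simp) hjk.symm
    have hδ := hxy i (by simp) k (by simp) hik
    set Δ := x i * y j - x j * y i with hΔ'
    set γ := x k * y j - x j * y k with hγ'
    set δ := x i * y k - x k * y i with hδ'
    -- Cramer's rule gives `Δ • (x k, y k) = γ • (x i, y i) + δ • (x j, y j)`. Comparing with `c k =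
    -- α • c i + β • c j` dictates the scalars at `i` and `j` once `r k = 1`.
    obtain ⟨a, ha, ha'⟩ := exists_dotProduct_eq (hc i j hij) (γ / (Δ * α) * x i)
      (δ / (Δ * β) * x j)
    obtain ⟨b, hb, hb'⟩ := exists_dotProduct_eq (hc i j hij) (γ / (Δ * α) * y i)
      (δ / (Δ * β) * y j)
    rw [dotProduct_comm] at ha ha' hb hb'
    refine ⟨a, b, fun z => if z = i then γ / (Δ * α) else if z = j then δ / (Δ * β) else 1, ?_⟩
    intro z hz
    simp only [Finset.mem_insert, Finset.mem_singleton] at hz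
    rcases hz with rfl | rfl | rfl
    · simp [ha, hb, hγ, hΔ, hα]
    · simp [hij.symm, ha', hb', hδ, hΔ, hβ]
    · simp only [hik.symm, hjk.symm, if_false, one_mul, ne_eq, one_ne_zero, not_false_eq_true,
        true_and]
      rw [← hk]
      simp only [dotProduct_add, dotProduct_smul, ha, ha', hb, hb', smul_eq_mul]
      constructor
      · field_simp
        rw [hΔ', hγ', hδ']
        ring
      · field_simp
        rw [hΔ', hγ', hδ']
        ring

/-- A point of the determinantal variety whose planes through the base line at the centers on that
line are pairwise distinct is a limit of points of the joint image. -/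
theorem mem_closure_jointImage_of_generic [NeZero m]
    (hC : Function.Injective fun i => (C i).center) {l : P2Pow m} {w₁ w₂ : Fin 4 → ℂ}
    (hw : LinearIndependent ℂ ![w₁, w₂]) {S : Finset (Fin m)} (hcard : S.card ≤ 3)
    (hS : ∀ i, i ∈ S ↔ w₁ ⬝ᵥ (C i).ctr = 0 ∧ w₂ ⬝ᵥ (C i).ctr = 0) {x y : Fin m → ℂ}
    (hl : ∀ i ∉ S, (C i).back (l i).rep ∈ span ℂ {w₁, w₂})
    (hlS : ∀ i ∈ S, ∃ r : ℂ, r ≠ 0 ∧ (C i).back (l i).rep = r • (x i • w₁ + y i • w₂))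
    (hxy : ∀ i ∈ S, ∀ j ∈ S, i ≠ j → x i * y j - x j * y i ≠ 0) :
    l ∈ closure (jointImage C) := by
  obtain ⟨a, b, r, hr⟩ := exists_interpolation (c := fun i => (C i).ctr) hcard
    (fun i => (C i).ctr_ne_zero) (fun i j hij => linearIndependent_ctr C hC hij)
    (E := perp (span ℂ {w₁, w₂}))
    (by rw [finrank_perp, finrank_span_pair_of_linearIndependent hw])
    (fun i hi => mem_perp_span_pair.mpr ((hS i).mp hi)) (x := x) (y := fun i => - y i)
    (fun i hi j hj hij h => hxy i hi j hj hij (by linear_combination -h))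
  -- At a center `c` on the base line, `join (v₁ t) (v₂ t) c` is `t` times `(a ⬝ᵥ c) • v₁ t - (b ⬝ᵥ
  -- c) • v₂ t`. Dividing by `t` gives the family `P`, which still makes sense at `t = 0`; the minus
  -- sign explains the `-y i` in the interpolation.
  let v₁ : (Unit → ℂ) → Fin 4 → ℂ := fun t => w₁ + t () • b
  let v₂ : (Unit → ℂ) → Fin 4 → ℂ := fun t => w₂ + t () • a
  have hv₁ : IsPolyVec v₁ := (IsPolyVec.const _).add (IsPolyVec.smul (coord_mem_polyFun _) (IsPolyVec.const _))
  have hv₂ : IsPolyVec v₂ := (IsPolyVec.const _).add (IsPolyVec.smul (coord_mem_polyFun _) (IsPolyVec.const _))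
  let P : (Unit → ℂ) → Fin m → Fin 3 → ℂ := fun t i =>
    if i ∈ S then (C i).inv ((a ⬝ᵥ (C i).ctr) • v₁ t - (b ⬝ᵥ (C i).ctr) • v₂ t)
    else imageCoords C (v₁ t) (v₂ t) i
  have hP : IsPolyFamily P := by
    intro i
    by_cases hi : i ∈ S
    · simp only [P, if_pos hi]
      exact IsPolyVec.map ((IsPolyVec.smul (const_mem_polyFun _) hv₁).sub
        (IsPolyVec.smul (const_mem_polyFun _) hv₂)) _
    · simp only [P, if_neg hi]
      exact isPolyFamily_imageCoords C hv₁ hv₂ i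
  have hP0 (i) : ∃ ρ : ℂ, ρ ≠ 0 ∧ P 0 i = ρ • (l i).rep := by
    have h1 : v₁ 0 = w₁ := by simp [v₁]
    have h2 : v₂ 0 = w₂ := by simp [v₂]
    by_cases hi : i ∈ S
    · obtain ⟨ρ, hρ, h⟩ := hlS i hi
      obtain ⟨hri, hra, hrb⟩ := hr i hi
      refine ⟨r i * ρ⁻¹, mul_ne_zero hri (inv_ne_zero hρ), ?_⟩
      have : (a ⬝ᵥ (C i).ctr) • v₁ 0 - (b ⬝ᵥ (C i).ctr) • v₂ 0 =
          (C i).back ((r i * ρ⁻¹) • (l i).rep) := by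
        rw [map_smul, h, hra, hrb, h1, h2, smul_smul, mul_assoc, inv_mul_cancel₀ hρ]
        module
      simp only [P, if_pos hi]
      rw [this, Camera.inv_back]
    · obtain ⟨ρ, hρ, h⟩ := exists_smul_eq_join (hl i hi) ((C i).back_rep_ne_zero _)
        ((C i).back_dotProduct_ctr _) (fun h => hi ((hS i).mpr h))
      refine ⟨ρ, hρ, (C i).back_injective ?_⟩
      simp only [P, if_neg hi]
      rw [back_imageCoords, h1, h2, h, map_smul]
  have hne (i) : P 0 i ≠ 0 := by
    obtain ⟨ρ, hρ, h⟩ := hP0 i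
    rw [h]
    exact smul_ne_zero hρ (l i).rep_nonzero
  have hpt : pt (P 0) hne = l := by
    refine Eq.trans ?_ (pt_rep l)
    refine pt_eq_of_smul _ _ fun i => ?_
    obtain ⟨ρ, -, h⟩ := hP0 i
    exact ⟨ρ, h.symm⟩
  rw [← hpt]
  refine hP.mem_closure (ι := Unit) (f := fun _ t => t ()) (fun _ => coord_mem_polyFun _)
    (fun _ => ⟨1, by simp⟩) ?_ hne
  intro t ht hPt
  have ht0 : t () ≠ 0 := ht ()
  have hrel (i) : ∃ ρ : ℂ, ρ ≠ 0 ∧ ρ • P t i = imageCoords C (v₁ t) (v₂ t) i := by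
    by_cases hi : i ∈ S
    · refine ⟨t (), ht0, ?_⟩
      simp only [P, if_pos hi]
      rw [imageCoords, ← map_smul]
      congr 1
      obtain ⟨h1, h2⟩ := (hS i).mp hi
      simp only [join, v₁, v₂, add_dotProduct, h1, h2, smul_dotProduct, zero_add, smul_sub,
        smul_smul, smul_eq_mul]
    · exact ⟨1, one_ne_zero, by simp only [P, if_neg hi, one_smul]⟩
  rw [mem_jointImage_iff_exists_imageCoords]
  refine ⟨v₁ t, v₂ t, fun i => ?_, pt_eq_of_smul _ _ fun i => ?_⟩
  · obtain ⟨ρ, hρ, h⟩ := hrel i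
    rw [← h]
    exact smul_ne_zero hρ (hPt i)
  · obtain ⟨ρ, hρ, h⟩ := hrel i
    exact ⟨ρ, h⟩

theorem areCollinear_of_forall_dotProduct_eq_zero
    (hC : Function.Injective fun i => (C i).center) {w₁ w₂ : Fin 4 → ℂ}
    (hw : LinearIndependent ℂ ![w₁, w₂]) {I : Finset (Fin m)} (hI : 1 < I.card)
    (h : ∀ i ∈ I, w₁ ⬝ᵥ (C i).ctr = 0 ∧ w₂ ⬝ᵥ (C i).ctr = 0) : AreCollinear C I := by
  have hmem {i} (hi : i ∈ I) :
      (C i).ctr ∈ (⨆ i ∈ I, (C i).center.submodule : Submodule ℂ (Fin 4 → ℂ)) := by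
    have : (C i).center.submodule ≤
        (⨆ i ∈ I, (C i).center.submodule : Submodule ℂ (Fin 4 → ℂ)) :=
      le_iSup₂_of_le i hi le_rfl
    rw [Camera.submodule_center] at this
    exact this (mem_span_singleton_self _)
  refine le_antisymm ?_ ?_
  · have h2 : finrank ℂ (perp (span ℂ {w₁, w₂})) = 2 := by
      rw [finrank_perp, finrank_span_pair_of_linearIndependent hw]
    rw [← h2]
    refine finrank_mono (iSup₂_le fun i hi => ?_)
    rw [Camera.submodule_center, span_singleton_le_iff_mem, mem_perp_span_pair]
    exact h i hi
  · obtain ⟨i, hi, j, hj, hij⟩ := Finset.one_lt_card.mp hI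
    rw [← finrank_span_pair_of_linearIndependent (linearIndependent_ctr C hC hij)]
    refine finrank_mono (span_le.mpr ?_)
    rintro _ (rfl | rfl)
    exacts [hmem hi, hmem hj]

/-- A double limit: with the base line fixed, the planes at the centers on it vary freely and are
generically distinct, and those generic points are limits of the joint image. -/
theorem determinantalVariety_subset_of_forall_not_areCollinear [NeZero m]
    (hC : Function.Injective fun i => (C i).center)
    (h : ∀ I : Finset (Fin m), I.card = 4 → ¬ AreCollinear C I) :
    determinantalVariety C ⊆ lineMultiviewVariety C := by
  classical
  intro l hl
  obtain ⟨w₁, w₂, hw, hspan⟩ := (mem_determinantalVariety_iff_exists C).mp hl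
  let S : Finset (Fin m) :=
    Finset.univ.filter fun i => w₁ ⬝ᵥ (C i).ctr = 0 ∧ w₂ ⬝ᵥ (C i).ctr = 0
  have hS (i) : i ∈ S ↔ w₁ ⬝ᵥ (C i).ctr = 0 ∧ w₂ ⬝ᵥ (C i).ctr = 0 := by simp [S]
  have hcard : S.card ≤ 3 := by
    by_contra! hlt
    obtain ⟨I, hIS, hI⟩ := Finset.exists_subset_card_eq (show 4 ≤ S.card from hlt)
    exact h I hI (areCollinear_of_forall_dotProduct_eq_zero C hC hw (by omega)
      fun i hi => (hS i).mp (hIS hi))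
  choose x y hxy using fun i => mem_span_pair.mp (hspan i)
  let P : (Fin m × Bool → ℂ) → Fin m → Fin 3 → ℂ := fun a i =>
    if i ∈ S then (C i).inv (a (i, false) • w₁ + a (i, true) • w₂) else (l i).rep
  have hP : IsPolyFamily P := by
    intro i
    by_cases hi : i ∈ S
    · simp only [P, if_pos hi]
      exact IsPolyVec.map ((IsPolyVec.smul (coord_mem_polyFun _) (IsPolyVec.const _)).add
        (IsPolyVec.smul (coord_mem_polyFun _) (IsPolyVec.const _))) _
    · simp only [P, if_neg hi]
      exact IsPolyVec.const _
  let a₀ : Fin m × Bool → ℂ := fun p => if p.2 then y p.1 else x p.1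
  have hP0 (i) : P a₀ i = (l i).rep := by
    by_cases hi : i ∈ S
    · simp only [P, if_pos hi]
      rw [← (C i).inv_back (l i).rep, ← hxy]
      rfl
    · simp only [P, if_neg hi]
  have hne (i) : P a₀ i ≠ 0 := by
    rw [hP0]
    exact (l i).rep_nonzero
  have hpt : pt (P a₀) hne = l :=
    (pt_eq_of_smul _ _ fun i => ⟨1, by rw [one_smul, hP0]⟩).trans (pt_rep l)
  rw [lineMultiviewVariety, ← closure_closure, ← hpt]
  refine hP.mem_closure (ι := {p : Fin m × Fin m // p.1 ≠ p.2})
    (f := fun p a => a (p.1.1, false) * a (p.1.2, true) - a (p.1.2, false) * a (p.1.1, true))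
    (fun p => sub_mem (mul_mem (coord_mem_polyFun _) (coord_mem_polyFun _))
      (mul_mem (coord_mem_polyFun _) (coord_mem_polyFun _))) ?_ ?_ hne
  · rintro ⟨⟨i, j⟩, hij⟩
    -- The points `(1 : i)` of ℙ¹ are pairwise distinct.
    refine ⟨fun p => if p.2 then ((p.1 : ℕ) : ℂ) else 1, ?_⟩
    simp only [if_true, one_mul, sub_ne_zero, Bool.false_eq_true, if_false]
    intro hc
    exact hij (Fin.ext (by exact_mod_cast hc.symm))
  · intro a ha hPa
    obtain ⟨r, hr, hrep⟩ := back_rep_pt C (P a) hPa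
    refine mem_closure_jointImage_of_generic C hC hw hcard hS
      (x := fun i => a (i, false)) (y := fun i => a (i, true)) ?_ ?_
      (fun i _ j _ hij => ha ⟨(i, j), hij⟩)
    · intro i hi
      rw [hrep]
      simp only [P, if_neg hi]
      exact smul_mem _ _ (hspan i)
    · intro i hi
      refine ⟨r i, hr i, ?_⟩
      rw [hrep]
      simp only [P, if_pos hi]
      rw [(C i).back_inv]
      simp [add_dotProduct, (hS i).mp hi]

end LineMultiview

end

noncomputable section

namespace LineMultiview

open MvPolynomial

variable {m n : ℕ} {σ : Type*}

/-! ### Algebraic independence along chains of prime ideals -/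

section Independence

variable {A : Type*} [CommRing A] [Algebra ℂ A]

/-- The elements `y` are algebraically independent modulo the ideal `I`. -/
def IndepMod (I : Ideal A) {k : ℕ} (y : Fin k → A) : Prop :=
  ∀ Q : MvPolynomial (Fin k) ℂ, aeval y Q ∈ I → Q = 0

theorem indepMod_of_isEmpty {I : Ideal A} (hI : I ≠ ⊤) (y : Fin 0 → A) : IndepMod I y := by
  intro Q hQ
  obtain ⟨c, rfl⟩ := C_surjective (Fin 0) Q
  by_contra hc
  have hc' : c ≠ 0 := by
    rintro rfl
    exact hc (map_zero _)
  refine hI (I.eq_top_of_isUnit_mem hQ ?_)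
  rw [aeval_C]
  exact (IsUnit.mk0 c hc').map (algebraMap ℂ A)

/-- A relation modulo `p` is a polynomial in `x` over `ℂ[y]`. Modulo `q` only its constant term
survives, which therefore is zero; then `x` can be cancelled modulo the prime `p`, and the argument
repeats. -/
theorem IndepMod.cons {p q : Ideal A} (hp : p.IsPrime) (hpq : p ≤ q) {x : A} (hxq : x ∈ q)
    (hxp : x ∉ p) {k : ℕ} {y : Fin k → A} (hy : IndepMod q y) :
    IndepMod p (Fin.cons x y : Fin (k + 1) → A) := by
  have key : ∀ S : Polynomial (MvPolynomial (Fin k) ℂ),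
      S.eval₂ (aeval y : MvPolynomial (Fin k) ℂ →ₐ[ℂ] A).toRingHom x ∈ p → S = 0 := by
    intro S
    induction S using Polynomial.recOnHorner with
    | M0 => exact fun _ => rfl
    | MC S a hS ha _ =>
      intro h
      rw [Polynomial.eval₂_add, Polynomial.eval₂_C] at h
      refine absurd (hy a ?_) ha
      have hSq : S.eval₂ (aeval y : MvPolynomial (Fin k) ℂ →ₐ[ℂ] A).toRingHom x ∈ q := by
        obtain ⟨T, rfl⟩ := Polynomial.X_dvd_iff.mpr hS
        rw [Polynomial.eval₂_mul, Polynomial.eval₂_X]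
        exact q.mul_mem_right _ hxq
      exact (q.add_mem_iff_right hSq).mp (hpq h)
    | MX S _ ih =>
      intro h
      rw [Polynomial.eval₂_mul, Polynomial.eval₂_X] at h
      rw [ih ((hp.mem_or_mem h).resolve_right hxp), zero_mul]
  have heval (Q : MvPolynomial (Fin (k + 1)) ℂ) : aeval (Fin.cons x y : Fin (k + 1) → A) Q =
      (finSuccEquiv ℂ k Q).eval₂ (aeval y : MvPolynomial (Fin k) ℂ →ₐ[ℂ] A).toRingHom x := by
    induction Q using MvPolynomial.induction_on with
    | C c => simp [finSuccEquiv_apply]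
    | add P Q hP hQ => rw [map_add, map_add, Polynomial.eval₂_add, hP, hQ]
    | mul_X P i hP =>
      rw [map_mul, map_mul, Polynomial.eval₂_mul, hP]
      congr 1
      refine Fin.cases ?_ (fun i => ?_) i
      · simp [finSuccEquiv_X_zero]
      · simp [finSuccEquiv_X_succ]
  intro Q hQ
  rw [heval] at hQ
  exact (map_eq_zero_iff _ (finSuccEquiv ℂ k).injective).mp (key _ hQ)

end Independence

/-- Independence modulo `I` persists modulo the smaller ideal `ker ψ`, hence in `K`, whose
transcendence degree is `n`. -/
theorem IndepMod.le_of_ker_le {K : Type} [Field K] [Algebra ℂ K] {A : Type*} [CommRing A]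
    [Algebra ℂ A] [Algebra (MvPolynomial (Fin n) ℂ) K] [IsScalarTower ℂ (MvPolynomial (Fin n) ℂ) K]
    [IsFractionRing (MvPolynomial (Fin n) ℂ) K] {I : Ideal A} (ψ : A →ₐ[ℂ] K)
    (hψ : RingHom.ker ψ ≤ I) {k : ℕ} {y : Fin k → A} (hy : IndepMod I y) : k ≤ n := by
  have hind : AlgebraicIndependent ℂ (fun i => ψ (y i)) := by
    rw [algebraicIndependent_iff]
    intro Q hQ
    refine hy Q (hψ ?_)
    rw [RingHom.mem_ker, ← hQ]
    exact (comp_aeval_apply _ ψ Q).symm ▸ rfl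
  have h1 := hind.cardinalMk_le_trdeg
  have : Algebra.IsAlgebraic (MvPolynomial (Fin n) ℂ) K :=
    IsLocalization.isAlgebraic K (nonZeroDivisors (MvPolynomial (Fin n) ℂ))
  have : FaithfulSMul (MvPolynomial (Fin n) ℂ) K :=
    (faithfulSMul_iff_algebraMap_injective _ _).mpr (IsFractionRing.injective _ _)
  have h2 := trdeg_add_eq ℂ (MvPolynomial (Fin n) ℂ) (A := K)
  rw [MvPolynomial.trdeg_of_isDomain, trdeg_eq_zero] at h2
  rw [← h2] at h1
  simpa using h1

/-! ### Affine charts -/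

theorem aeval_apply_eq_eval (x : σ → ℂ) (f : MvPolynomial σ ℂ) : aeval x f = eval x f :=
  RingHom.congr_fun (coe_aeval_eq_eval x) f

/-- Homogenisation with respect to the coordinates `x_{i, k i}`. -/
theorem exists_homogenization (k : Fin m → Fin 3) (f : CoordRing m) :
    ∃ e₀ : Fin m → ℕ, ∀ e, e₀ ≤ e → ∃ F : CoordRing m,
      IsWeightedHomogeneous (fun p : Fin m × Fin 3 => (Pi.single p.1 1 : Fin m → ℕ)) F e ∧
      ∀ {K : Type} [Field K] [Algebra ℂ K] (x : Fin m × Fin 3 → K), (∀ i, x (i, k i) ≠ 0) →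
        aeval x F = (∏ i, x (i, k i) ^ e i) * aeval (fun p => x p / x (p.1, k p.1)) f := by
  induction f using MvPolynomial.induction_on with
  | C c =>
    refine ⟨0, fun e _ => ⟨C c * ∏ i, X (i, k i) ^ e i, ?_, ?_⟩⟩
    · have h1 := IsWeightedHomogeneous.prod Finset.univ (fun i => (X (i, k i) : CoordRing m) ^ e i)
        (fun i => e i • (Pi.single i 1 : Fin m → ℕ))
        (w := fun p : Fin m × Fin 3 => (Pi.single p.1 1 : Fin m → ℕ))
        (fun i _ => (isWeightedHomogeneous_X ℂ _ (i, k i)).pow (e i))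
      have h2 : ∑ i, e i • (Pi.single i 1 : Fin m → ℕ) = e := by
        ext j
        simp [Finset.sum_apply, Pi.single_apply]
      rw [h2] at h1
      simpa using (isWeightedHomogeneous_C _ c).mul h1
    · intro K _ _ x _
      simp [mul_comm]
  | add f g hf hg =>
    obtain ⟨e₁, h₁⟩ := hf
    obtain ⟨e₂, h₂⟩ := hg
    -- Every sufficiently large degree is allowed, so both summands can be homogenised in the same
    -- degree.
    refine ⟨e₁ ⊔ e₂, fun e he => ?_⟩
    obtain ⟨F, hF, hF'⟩ := h₁ e (le_sup_left.trans he)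
    obtain ⟨G, hG, hG'⟩ := h₂ e (le_sup_right.trans he)
    refine ⟨F + G, hF.add hG, fun x hx => ?_⟩
    rw [map_add, map_add, hF' x hx, hG' x hx, mul_add]
  | mul_X f p hf =>
    obtain ⟨e₁, h₁⟩ := hf
    refine ⟨e₁ + Pi.single p.1 1, fun e he => ?_⟩
    obtain ⟨e', rfl⟩ := exists_add_of_le ((le_add_self).trans he)
    rw [add_comm (Pi.single p.1 1) e'] at he ⊢
    obtain ⟨F, hF, hF'⟩ := h₁ e' (le_of_add_le_add_right he)
    refine ⟨F * X p, hF.mul (isWeightedHomogeneous_X ℂ _ p), fun x hx => ?_⟩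
    rw [map_mul, map_mul, aeval_X, aeval_X, hF' x hx]
    have : ∏ i, x (i, k i) ^ (e' + Pi.single p.1 1 : Fin m → ℕ) i =
        (∏ i, x (i, k i) ^ e' i) * x (p.1, k p.1) := by
      simp only [Pi.add_apply, pow_add, Finset.prod_mul_distrib]
      congr 1
      rw [Finset.prod_eq_single p.1]
      · simp
      · intro b _ hb
        simp [hb]
      · simp
    rw [this]
    field_simp [hx p.1]

/-- The affine chart where the coordinates `x_{i, k i}` do not vanish. -/
def chart (k : Fin m → Fin 3) : Set (P2Pow m) := {l | ∀ i, (l i).rep (k i) ≠ 0}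

theorem isOpen_chart (k : Fin m → Fin 3) : IsOpen (chart k) := by
  have : chart k = ⋂ i, {l : P2Pow m | (l i).rep ⬝ᵥ Pi.single (k i) 1 ≠ 0} := by
    ext l
    simp [chart]
  rw [this]
  exact isOpen_iInter_of_finite fun i => isOpen_linForm_ne_zero i _

/-- The coordinates normalised by `x_{i, k i} = 1`. -/
def chartCoords (k : Fin m → Fin 3) (l : P2Pow m) (p : Fin m × Fin 3) : ℂ :=
  coords l p / coords l (p.1, k p.1)

/-- The same `F` serves at closed points and at the generic point of a parametrisation, whose
coordinates lie in a function field `K`. -/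
theorem exists_eval_chartCoords (k : Fin m → Fin 3) (f : CoordRing m) :
    ∃ F : CoordRing m, IsMultihomogeneous F ∧
      (∀ l ∈ chart k, eval (coords l) F = 0 ↔ eval (chartCoords k l) f = 0) ∧
      ∀ {K : Type} [Field K] [Algebra ℂ K] (x : Fin m × Fin 3 → K), (∀ i, x (i, k i) ≠ 0) →
        aeval (fun p => x p / x (p.1, k p.1)) f = 0 → aeval x F = 0 := by
  obtain ⟨e, he⟩ := exists_homogenization k f
  obtain ⟨F, hF, hF'⟩ := he e le_rfl
  refine ⟨F, ⟨e, hF⟩, fun l hl => ?_, fun x hx h => by rw [hF' x hx, h, mul_zero]⟩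
  have := hF' (coords l) hl
  rw [aeval_apply_eq_eval, aeval_apply_eq_eval] at this
  rw [this, mul_eq_zero, or_iff_right]
  · rfl
  · exact Finset.prod_ne_zero_iff.mpr fun i _ => pow_ne_zero _ (hl i)

theorem eval_chartCoords_eq_zero_iff {k : Fin m → Fin 3} {f : CoordRing m}
    (hf : IsMultihomogeneous f) {l : P2Pow m} (hl : l ∈ chart k) :
    eval (chartCoords k l) f = 0 ↔ eval (coords l) f = 0 := by
  rw [← hf.eval_mul_eq_zero_iff (c := fun i => (coords l (i, k i))⁻¹)
    (fun i => inv_ne_zero (hl i)) (coords l)]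
  have : chartCoords k l = fun p => (coords l (p.1, k p.1))⁻¹ * coords l p :=
    funext fun p => div_eq_inv_mul _ _
  rw [this]

/-- The ideal of a subset of `(ℙ²)^m` in an affine chart. -/
def chartIdeal (k : Fin m → Fin 3) (Z : Set (P2Pow m)) : Ideal (CoordRing m) :=
  ⨅ l ∈ Z ∩ chart k, RingHom.ker (eval (chartCoords k l))

theorem mem_chartIdeal {k : Fin m → Fin 3} {Z : Set (P2Pow m)} {f : CoordRing m} :
    f ∈ chartIdeal k Z ↔ ∀ l ∈ Z, l ∈ chart k → eval (chartCoords k l) f = 0 := by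
  simp [chartIdeal, RingHom.mem_ker, and_imp]

theorem chartIdeal_anti {k : Fin m → Fin 3} {Z W : Set (P2Pow m)} (h : Z ⊆ W) :
    chartIdeal k W ≤ chartIdeal k Z := fun f hf => by
  rw [mem_chartIdeal] at hf ⊢
  exact fun l hl => hf l (h hl)

theorem chartIdeal_ne_top {k : Fin m → Fin 3} {Z : Set (P2Pow m)} (h : (Z ∩ chart k).Nonempty) :
    chartIdeal k Z ≠ ⊤ := by
  obtain ⟨l, hl, hlk⟩ := h
  rw [Ideal.ne_top_iff_one, mem_chartIdeal]
  intro h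
  simpa using h l hl hlk

theorem isPrime_chartIdeal {k : Fin m → Fin 3} {Z : Set (P2Pow m)} (hZ : IsIrreducible Z)
    (h : (Z ∩ chart k).Nonempty) : (chartIdeal k Z).IsPrime := by
  refine ⟨chartIdeal_ne_top h, ?_⟩
  intro f g hfg
  by_contra! hc
  simp only [mem_chartIdeal, not_forall] at hc hfg
  obtain ⟨⟨a, haZ, hak, ha⟩, ⟨b, hbZ, hbk, hb⟩⟩ := hc
  obtain ⟨F, hF, hF', -⟩ := exists_eval_chartCoords k f
  obtain ⟨G, hG, hG', -⟩ := exists_eval_chartCoords k g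
  obtain ⟨l, hlZ, ⟨hlk, hlF⟩, -, hlG⟩ := hZ.2 (chart k ∩ {l | eval (coords l) F = 0}ᶜ)
    (chart k ∩ {l | eval (coords l) G = 0}ᶜ)
    ((isOpen_chart k).inter (isClosed_zeroLocus hF).isOpen_compl)
    ((isOpen_chart k).inter (isClosed_zeroLocus hG).isOpen_compl)
    ⟨a, haZ, hak, fun h => ha ((hF' a hak).mp h)⟩ ⟨b, hbZ, hbk, fun h => hb ((hG' b hbk).mp h)⟩
  have := hfg l hlZ hlk
  rw [map_mul, mul_eq_zero] at this
  rcases this with h | h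
  · exact hlF ((hF' l hlk).mpr h)
  · exact hlG ((hG' l hlk).mpr h)

/-- An irreducible set is contained in the closure of its nonempty part in the chart, so the chart
ideals detect strict inclusions. -/
theorem exists_mem_chartIdeal_notMem {k : Fin m → Fin 3} {Z W : Set (P2Pow m)} (hZ : IsClosed Z)
    (hW : IsIrreducible W) (hWk : (W ∩ chart k).Nonempty) (h : ¬ W ⊆ Z) :
    ∃ f ∈ chartIdeal k Z, f ∉ chartIdeal k W := by
  by_contra! hc
  apply h
  refine (subset_closure_inter_of_isPreirreducible_of_isOpen hW.2 (isOpen_chart k) hWk).trans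
    (hZ.closure_subset_iff.mpr ?_)
  rintro l ⟨hlW, hlk⟩
  obtain ⟨S, hS, rfl⟩ := isClosed_iff_isAlgebraic.mp hZ
  intro f hf
  rw [← eval_chartCoords_eq_zero_iff (hS f hf) hlk]
  refine mem_chartIdeal.mp (hc f ?_) l hlW hlk
  rw [mem_chartIdeal]
  intro z hz hzk
  rw [eval_chartCoords_eq_zero_iff (hS f hf) hzk]
  exact hz f hf

/-! ### The dimension of a parametrised set is at most the number of parameters -/

theorem exists_chart (l : P2Pow m) : ∃ k, l ∈ chart k := by
  have : ∀ i, ∃ j, (l i).rep j ≠ 0 := fun i => Function.ne_iff.mp (l i).rep_nonzero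
  choose k hk using this
  exact ⟨k, hk⟩

/-- In a chart meeting the smallest member, the chain becomes a strict chain of primes.
`IndepMod.cons` adds one independent element per inclusion, and all of them stay independent in the
field of rational functions in the `n` parameters. -/
theorem length_le_of_last_subset_closure_locus {P : (Fin n → ℂ) → Fin m → Fin 3 → ℂ}
    (hP : IsPolyFamily P) (s : LTSeries (TopologicalSpace.IrreducibleCloseds (P2Pow m)))
    (hs : (s.last : Set (P2Pow m)) ⊆ closure (locus P)) : s.length ≤ n := by
  obtain ⟨z, hz⟩ := s.head.isIrreducible.nonempty
  obtain ⟨k, hk⟩ := exists_chart z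
  have hne (i) : ((s i : Set (P2Pow m)) ∩ chart k).Nonempty :=
    ⟨z, (s.head_le i : (s.head : Set (P2Pow m)) ⊆ s i) hz, hk⟩
  have hindep : ∀ j (hj : j < s.length + 1), ∃ y : Fin j → CoordRing m,
      IndepMod (chartIdeal k (s ⟨j, hj⟩)) y := by
    intro j
    induction j with
    | zero => exact fun hj => ⟨Fin.elim0, indepMod_of_isEmpty (chartIdeal_ne_top (hne _)) _⟩
    | succ j ih =>
      intro hj
      obtain ⟨y, hy⟩ := ih (by omega)
      have hlt : s ⟨j, by omega⟩ < s ⟨j + 1, hj⟩ := s.strictMono (by simp)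
      obtain ⟨f, hf, hf'⟩ := exists_mem_chartIdeal_notMem (k := k) (s ⟨j, by omega⟩).isClosed
        (s ⟨j + 1, hj⟩).isIrreducible (hne _) hlt.not_ge
      exact ⟨_, hy.cons (isPrime_chartIdeal (s ⟨j + 1, hj⟩).isIrreducible (hne _))
        (chartIdeal_anti hlt.le) hf hf'⟩
  obtain ⟨y, hy⟩ := hindep s.length (by omega)
  have hlast : s ⟨s.length, by omega⟩ = s.last := rfl
  rw [hlast] at hy
  have hq (p : Fin m × Fin 3) : ∃ Q : MvPolynomial (Fin n) ℂ, ∀ a, P a p.1 p.2 = eval a Q :=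
    mem_polyFun.mp (hP p.1 p.2)
  choose q hq using hq
  -- The locus meets the open chart because its closure does, so the coordinates used as
  -- denominators are nonzero polynomials.
  have hq0 (i) : q (i, k i) ≠ 0 := by
    intro h0
    obtain ⟨l, hlk, a, ha, rfl⟩ := mem_closure_iff.mp
      (hs ((s.head_le_last : (s.head : Set (P2Pow m)) ⊆ s.last) hz)) _ (isOpen_chart k) hk
    obtain ⟨c, hc, hrep⟩ := exists_rep_pt _ ha
    apply hlk i
    rw [hrep, Pi.smul_apply, hq (i, k i), h0]
    simp
  let K := FractionRing (MvPolynomial (Fin n) ℂ)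
  let x : Fin m × Fin 3 → K := fun p => algebraMap _ K (q p)
  have hx (i) : x (i, k i) ≠ 0 :=
    (map_ne_zero_iff _ (IsFractionRing.injective (MvPolynomial (Fin n) ℂ) K)).mpr (hq0 i)
  refine hy.le_of_ker_le (n := n) (aeval fun p => x p / x (p.1, k p.1) : CoordRing m →ₐ[ℂ] K) ?_
  intro f hf
  obtain ⟨F, hF, hFf, hFK⟩ := exists_eval_chartCoords k f
  have h0 : aeval q F = 0 := by
    have := hFK x hx hf
    have h2 : aeval x F = algebraMap _ K (aeval q F) :=
      (comp_aeval_apply q (IsScalarTower.toAlgHom ℂ (MvPolynomial (Fin n) ℂ) K) F).symm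
    rw [h2] at this
    exact (map_eq_zero_iff _ (IsFractionRing.injective (MvPolynomial (Fin n) ℂ) K)).mp this
  rw [mem_chartIdeal]
  intro l hl hlk
  rw [← hFf l hlk]
  refine mem_closure_iff_eval.mp (hs hl) F hF ?_
  rintro _ ⟨a, ha, rfl⟩
  rw [← pullback_eq_zero_iff hF ha]
  have : pullback P F a = eval a (aeval q F) := by
    have h3 : (fun p : Fin m × Fin 3 => P a p.1 p.2) = fun p => eval a (q p) :=
      funext fun p => hq p a
    rw [pullback, h3, ← aeval_apply_eq_eval a, comp_aeval_apply, ← aeval_apply_eq_eval]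
    simp only [aeval_apply_eq_eval]
  rw [this, h0, map_zero]

theorem topologicalKrullDim_closure_locus_le {P : (Fin n → ℂ) → Fin m → Fin 3 → ℂ}
    (hP : IsPolyFamily P) : topologicalKrullDim (closure (locus P)) ≤ n := by
  refine iSup_le fun s => ?_
  have hmap := TopologicalSpace.IrreducibleCloseds.map_strictMono_of_isInducing
    (Topology.IsInducing.subtypeVal (t := closure (locus P)))
  have := length_le_of_last_subset_closure_locus hP (s.map _ hmap) (by
    refine closure_minimal ?_ isClosed_closure
    rintro _ ⟨l, -, rfl⟩
    exact l.2)
  exact_mod_cast this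

theorem isIrreducible_preimage_val {X : Type*} [TopologicalSpace X] {V Z : Set X}
    (hZ : IsIrreducible Z) (h : Z ⊆ V) : IsIrreducible (Subtype.val ⁻¹' Z : Set V) := by
  obtain ⟨⟨z, hz⟩, hZ⟩ := hZ
  refine ⟨⟨⟨z, h hz⟩, hz⟩, ?_⟩
  rintro _ _ ⟨U, hU, rfl⟩ ⟨W, hW, rfl⟩ ⟨a, haZ, haU⟩ ⟨b, hbZ, hbW⟩
  obtain ⟨c, hcZ, hcU, hcW⟩ := hZ U W hU hW ⟨a, haZ, haU⟩ ⟨b, hbZ, hbW⟩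
  exact ⟨⟨c, h hcZ⟩, hcZ, hcU, hcW⟩

/-- A chain of irreducible closed subsets of a subset bounds its dimension from below. -/
theorem le_topologicalKrullDim_of_strictMono {X : Type*} [TopologicalSpace X] {V : Set X} {N : ℕ}
    (Z : Fin (N + 1) → Set X) (hirr : ∀ k, IsIrreducible (Z k)) (hcl : ∀ k, IsClosed (Z k))
    (hV : ∀ k, Z k ⊆ V) (hle : ∀ k : Fin N, Z k.castSucc ⊆ Z k.succ)
    (hne : ∀ k : Fin N, ¬ Z k.succ ⊆ Z k.castSucc) : (N : WithBot ℕ∞) ≤ topologicalKrullDim V := by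
  let T : Fin (N + 1) → TopologicalSpace.IrreducibleCloseds V := fun k =>
    ⟨Subtype.val ⁻¹' Z k, isIrreducible_preimage_val (hirr k) (hV k),
      (hcl k).preimage continuous_subtype_val⟩
  have hT : StrictMono T := by
    rw [Fin.strictMono_iff_lt_succ]
    intro k
    refine lt_of_le_not_ge (fun x hx => hle k hx) fun h => hne k fun x hx => ?_
    exact h (show (⟨x, hV _ hx⟩ : V) ∈ T k.succ from hx)
  exact Order.LTSeries.length_le_krullDim (LTSeries.mk N T hT)

end LineMultiview

end

noncomputable section

namespace LineMultiview

open Module Submodule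

variable {m : ℕ} (C : Fin m → Camera)

/-! ### A birational parametrisation by two image lines -/

theorem join_smul_smul (s t : ℂ) (u v c : Fin 4 → ℂ) :
    join (s • u) (t • v) c = (s * t) • join u v c := by
  simp only [join, smul_dotProduct, smul_eq_mul]
  module

/-- Replacing the generators of a pencil by its members through `c` and `c'` changes every join by
one common scalar. -/
theorem join_join (w₁ w₂ c c' d : Fin 4 → ℂ) :
    join (join w₁ w₂ c) (join w₁ w₂ c') d = (join w₁ w₂ c' ⬝ᵥ c) • join w₁ w₂ d := by
  simp only [join, sub_dotProduct, smul_dotProduct, smul_eq_mul]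
  module

variable (i₀ i₁ : Fin m)

/-- Images of lines in the family cut out by the back-projections of `(1, a₀, a₁)` under the camera
`i₀` and `(1, a₂, a₃)` under the camera `i₁`. -/
def pairFamily (a : Fin 4 → ℂ) : Fin m → Fin 3 → ℂ :=
  imageCoords C ((C i₀).back ![1, a 0, a 1]) ((C i₁).back ![1, a 2, a 3])

theorem isPolyFamily_pairFamily : IsPolyFamily (pairFamily C i₀ i₁) := by
  refine isPolyFamily_imageCoords C (IsPolyVec.map ?_ _) (IsPolyVec.map ?_ _) <;>
  · intro k
    fin_cases k
    exacts [const_mem_polyFun 1, coord_mem_polyFun _, coord_mem_polyFun _]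

theorem pairFamily_left (a : Fin 4 → ℂ) : ∃ r : ℂ, pairFamily C i₀ i₁ a i₀ = r • ![1, a 0, a 1] :=
  ⟨_, by rw [pairFamily, imageCoords, join, Camera.back_dotProduct_ctr, zero_smul, sub_zero,
    map_smul, Camera.inv_back]⟩

theorem pairFamily_right (a : Fin 4 → ℂ) : ∃ r : ℂ, pairFamily C i₀ i₁ a i₁ = r • ![1, a 2, a 3] :=
  ⟨_, by rw [pairFamily, imageCoords, join, Camera.back_dotProduct_ctr, zero_smul, zero_sub,
    ← neg_smul, map_smul, Camera.inv_back]⟩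

theorem locus_pairFamily_subset [NeZero m] : locus (pairFamily C i₀ i₁) ⊆ jointImage C := by
  rintro _ ⟨a, h, rfl⟩
  exact (mem_jointImage_iff_exists_imageCoords C).mpr ⟨_, _, h, rfl⟩

theorem jointImage_subset_closure_locus_pairFamily [NeZero m]
    (hC : Function.Injective fun i => (C i).center) (h01 : i₁ ≠ i₀) :
    jointImage C ⊆ closure (locus (pairFamily C i₀ i₁)) := by
  have hJ := isPolyFamily_jointFamily C
  rw [← locus_jointFamily]
  rintro _ ⟨a, ha, rfl⟩
  -- Generically both image lines can be normalised to first coordinate 1, and the plane from `i₁`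
  -- misses the center of `i₀`, so the two planes again cut out the line.
  refine hJ.mem_closure (ι := Fin 3)
    (f := ![fun a => jointFamily C a i₀ 0, fun a => jointFamily C a i₁ 0,
      fun a => (C i₁).back (jointFamily C a i₁) ⬝ᵥ (C i₀).ctr]) ?_ ?_ ?_ ha
  · intro k
    fin_cases k
    exacts [hJ i₀ 0, hJ i₁ 0, (IsPolyVec.map (hJ i₁) _).dotProduct_const _]
  · intro k
    fin_cases k
    · obtain ⟨a, ha⟩ := exists_jointFamily_eq C i₀ (Pi.single 0 1)
      exact ⟨a, by simp [ha]⟩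
    · obtain ⟨a, ha⟩ := exists_jointFamily_eq C i₁ (Pi.single 0 1)
      exact ⟨a, by simp [ha]⟩
    · obtain ⟨w₁, w₂, h⟩ := exists_join_dotProduct_ne_zero (linearIndependent_ctr C hC h01)
      refine ⟨fun p => ![w₁, w₂] p.1 p.2, ?_⟩
      show (C i₁).back (jointFamily C _ i₁) ⬝ᵥ (C i₀).ctr ≠ 0
      rwa [jointFamily_apply, back_imageCoords]
  · intro a ha hne
    have hx : jointFamily C a i₀ 0 ≠ 0 := ha 0
    have hy : jointFamily C a i₁ 0 ≠ 0 := ha 1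
    have hd : (C i₁).back (jointFamily C a i₁) ⬝ᵥ (C i₀).ctr ≠ 0 := ha 2
    set x := jointFamily C a i₀ with hx'
    set y := jointFamily C a i₁ with hy'
    have hxn : ![1, x 1 / x 0, x 2 / x 0] = (x 0)⁻¹ • x := by
      ext k
      fin_cases k <;> simp [hx, div_eq_inv_mul]
    have hyn : ![1, y 1 / y 0, y 2 / y 0] = (y 0)⁻¹ • y := by
      ext k
      fin_cases k <;> simp [hy, div_eq_inv_mul]
    have hrel (i) : pairFamily C i₀ i₁ ![x 1 / x 0, x 2 / x 0, y 1 / y 0, y 2 / y 0] i =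
        ((x 0)⁻¹ * (y 0)⁻¹ * ((C i₁).back y ⬝ᵥ (C i₀).ctr)) • jointFamily C a i := by
      have h1 : (C i₀).back x = join _ _ (C i₀).ctr := back_imageCoords C _ _ i₀
      have h2 : (C i₁).back y = join _ _ (C i₁).ctr := back_imageCoords C _ _ i₁
      show (C i).inv (join ((C i₀).back ![1, x 1 / x 0, x 2 / x 0])
        ((C i₁).back ![1, y 1 / y 0, y 2 / y 0]) (C i).ctr) = _
      rw [hxn, hyn, map_smul, map_smul, join_smul_smul, h1, h2, join_join, smul_smul, map_smul]
      rfl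
    have hr : (x 0)⁻¹ * (y 0)⁻¹ * ((C i₁).back y ⬝ᵥ (C i₀).ctr) ≠ 0 :=
      mul_ne_zero (mul_ne_zero (inv_ne_zero hx) (inv_ne_zero hy)) hd
    refine ⟨_, fun i => ?_, pt_eq_of_smul _ _ fun i => ⟨_, (hrel i).symm⟩⟩
    rw [hrel]
    exact smul_ne_zero hr (hne i)

theorem closure_locus_pairFamily [NeZero m] (hC : Function.Injective fun i => (C i).center)
    (h01 : i₁ ≠ i₀) : closure (locus (pairFamily C i₀ i₁)) = lineMultiviewVariety C :=
  (closure_mono (locus_pairFamily_subset C i₀ i₁)).antisymm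
    (closure_minimal (jointImage_subset_closure_locus_pairFamily C i₀ i₁ hC h01) isClosed_closure)

/-- Each parameter of the family is determined by a multihomogeneous equation. -/
theorem exists_parameter_equation (k : Fin 4) (c : ℂ) :
    ∃ F : CoordRing m, IsMultihomogeneous F ∧ ∀ a (h : ∀ i, pairFamily C i₀ i₁ a i ≠ 0),
      MvPolynomial.eval (coords (pt _ h)) F = 0 ↔ a k = c := by
  have key (i : Fin m) (b : Fin 3 → ℂ) (v : (Fin 4 → ℂ) → Fin 3 → ℂ)
      (hv : ∀ a, ∃ r : ℂ, pairFamily C i₀ i₁ a i = r • v a) (hb : ∀ a, v a ⬝ᵥ b = a k - c) :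
      ∃ F : CoordRing m, IsMultihomogeneous F ∧ ∀ a (h : ∀ i, pairFamily C i₀ i₁ a i ≠ 0),
        MvPolynomial.eval (coords (pt _ h)) F = 0 ↔ a k = c := by
    have hF : IsMultihomogeneous (linForm i b) := ⟨_, linForm_isWeightedHomogeneous i b⟩
    refine ⟨linForm i b, hF, fun a h => ?_⟩
    obtain ⟨r, hr⟩ := hv a
    have hr0 : r ≠ 0 := by
      rintro rfl
      exact h i (by rw [hr, zero_smul])
    rw [eval_coords_pt hF, eval_linForm]
    show pairFamily C i₀ i₁ a i ⬝ᵥ b = 0 ↔ _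
    rw [hr, smul_dotProduct, hb, smul_eq_mul, mul_eq_zero, or_iff_right hr0, sub_eq_zero]
  have hl := pairFamily_left C i₀ i₁
  have hr := pairFamily_right C i₀ i₁
  fin_cases k
  · exact key i₀ ![-c, 1, 0] _ hl fun a => by simp [dotProduct, Fin.sum_univ_three]; ring
  · exact key i₀ ![-c, 0, 1] _ hl fun a => by simp [dotProduct, Fin.sum_univ_three]; ring
  · exact key i₁ ![-c, 1, 0] _ hr fun a => by simp [dotProduct, Fin.sum_univ_three]; ring
  · exact key i₁ ![-c, 0, 1] _ hr fun a => by simp [dotProduct, Fin.sum_univ_three]; ring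

/-! ### The dimension of the line multiview variety -/

theorem topologicalKrullDim_lineMultiviewVariety (hm : 2 ≤ m)
    (hC : Function.Injective fun i => (C i).center) :
    topologicalKrullDim (lineMultiviewVariety C) = 4 := by
  have : NeZero m := ⟨by omega⟩
  have : Nontrivial (Fin m) := Fin.nontrivial_iff_two_le.mpr hm
  obtain ⟨i₀, i₁, h01⟩ := exists_pair_ne (Fin m)
  have hcl := closure_locus_pairFamily C i₀ i₁ hC h01.symm
  have hQ := isPolyFamily_pairFamily C i₀ i₁
  refine le_antisymm ?_ ?_
  · rw [← hcl]
    exact topologicalKrullDim_closure_locus_le hQ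
  obtain ⟨_, p, hp, -⟩ : (locus (pairFamily C i₀ i₁)).Nonempty := by
    rw [← closure_nonempty_iff, hcl]
    exact (jointImage_nonempty C).closure
  -- The first `k` parameters are free and the rest are frozen at the base point `p`; the closures
  -- of these families for `k = 0, …, 4` form the chain.
  let cut : Fin 5 → (Fin 4 → ℂ) → Fin 4 → ℂ := fun k a j => if j.castSucc < k then a j else p j
  have hcut (k) : cut k p = p := by
    ext j
    simp [cut]
  let R : Fin 5 → (Fin 4 → ℂ) → Fin m → Fin 3 → ℂ := fun k a => pairFamily C i₀ i₁ (cut k a)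
  have hR (k) : IsPolyFamily (R k) := by
    intro i j
    obtain ⟨Q, hQ⟩ := mem_polyFun.mp (hQ i j)
    have : (fun a => R k a i j) = fun a => MvPolynomial.eval (cut k a) Q := funext fun a => hQ _
    rw [this]
    refine eval_mem_polyFun (fun t => ?_) Q
    by_cases ht : t.castSucc < k
    · simp only [cut, if_pos ht]
      exact coord_mem_polyFun t
    · simp only [cut, if_neg ht]
      exact const_mem_polyFun _
  have hRp (k i) : R k p i ≠ 0 := by
    simp only [R, hcut]
    exact hp i
  have hsub (k) : locus (R k) ⊆ locus (pairFamily C i₀ i₁) := by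
    rintro _ ⟨a, ha, rfl⟩
    exact ⟨_, ha, rfl⟩
  refine le_topologicalKrullDim_of_strictMono (N := 4) (fun k => closure (locus (R k)))
    (fun k => ⟨⟨_, subset_closure ⟨p, hRp k, rfl⟩⟩, (hR k).isPreirreducible_locus.closure⟩)
    (fun k => isClosed_closure) (fun k => hcl ▸ closure_mono (hsub k)) (fun k => ?_) (fun k => ?_)
  · refine closure_mono ?_
    rintro _ ⟨a, ha, rfl⟩
    have h : cut k.succ (cut k.castSucc a) = cut k.castSucc a := by
      ext j
      simp only [cut]
      by_cases hj : j.castSucc < k.castSucc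
      · simp [hj, hj.trans k.castSucc_lt_succ]
      · simp [hj]
    have hRk : R k.succ (cut k.castSucc a) = R k.castSucc a := by
      simp only [R, h]
    exact ⟨cut k.castSucc a, fun i => by rw [hRk]; exact ha i,
      pt_eq_of_smul _ _ fun i => ⟨1, by rw [one_smul, hRk]⟩⟩
  · intro hle
    -- The equation fixing the `k`-th parameter at `p k` holds on the smaller closure and fails at a
    -- generic point of the larger family.
    obtain ⟨F, hF, hFp⟩ := exists_parameter_equation C i₀ i₁ k (p k)
    obtain ⟨a, ha, hak⟩ := (hR k.succ).exists_generic (fun i => ⟨p, hRp _ i⟩) (ι := Unit)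
      (f := fun _ a => a k - p k)
      (fun _ => sub_mem (coord_mem_polyFun k) (const_mem_polyFun _))
      (fun _ => ⟨fun j => p j + 1, by simp⟩)
    have h1 : MvPolynomial.eval (coords (pt (R k.succ a) ha)) F = 0 := by
      refine mem_closure_iff_eval.mp (hle (subset_closure ⟨a, ha, rfl⟩)) F hF ?_
      rintro _ ⟨b, hb, rfl⟩
      refine (hFp _ hb).mpr ?_
      simp [cut]
    have h2 := (hFp _ ha).mp h1
    simp only [cut, Fin.castSucc_lt_succ, if_true] at h2
    exact hak () (sub_eq_zero.mpr h2)

theorem isIrreducible_lineMultiviewVariety [NeZero m] : IsIrreducible (lineMultiviewVariety C) :=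
  ⟨(jointImage_nonempty C).closure, (isPreirreducible_jointImage C).closure⟩

theorem lineMultiviewVariety_subset_determinantalVariety :
    lineMultiviewVariety C ⊆ determinantalVariety C :=
  closure_minimal (jointImage_subset_determinantalVariety C) (isClosed_determinantalVariety C)

end LineMultiview

end

/-- For `m ≥ 2` pinhole cameras with distinct centers, the line multiview variety is the
determinantal variety if and only if no four cameras are collinear, and this is precisely when the
determinantal variety is irreducible of dimension `4`. -/
theorem theorem2p4 (m : ℕ) (hm : 2 ≤ m) (C : Fin m → LineMultiview.Camera)
    (hC : Function.Injective fun i => (C i).center) :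
    (LineMultiview.lineMultiviewVariety C = LineMultiview.determinantalVariety C ↔
      ∀ I : Finset (Fin m), I.card = 4 → ¬ LineMultiview.AreCollinear C I) ∧
    ((IsIrreducible (LineMultiview.determinantalVariety C) ∧
        topologicalKrullDim (LineMultiview.determinantalVariety C) = 4) ↔
      ∀ I : Finset (Fin m), I.card = 4 → ¬ LineMultiview.AreCollinear C I) := by
  have : NeZero m := ⟨by omega⟩
  have hle := LineMultiview.lineMultiviewVariety_subset_determinantalVariety C
  have heq : LineMultiview.lineMultiviewVariety C = LineMultiview.determinantalVariety C ↔
      ∀ I : Finset (Fin m), I.card = 4 → ¬ LineMultiview.AreCollinear C I :=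
    ⟨fun h I hI hcol => LineMultiview.not_subset_of_areCollinear C hC hI hcol h.ge,
      fun h => hle.antisymm
        (LineMultiview.determinantalVariety_subset_of_forall_not_areCollinear C hC h)⟩
  refine ⟨heq, ?_⟩
  rw [← heq]
  constructor
  · rintro ⟨hirr, -⟩
    exact hle.antisymm
      (LineMultiview.determinantalVariety_subset_of_isIrreducible C hm hC hirr)
  · intro h
    rw [← h]
    exact ⟨LineMultiview.isIrreducible_lineMultiviewVariety C,
      LineMultiview.topologicalKrullDim_lineMultiviewVariety C hm hC⟩
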